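/- Let $\mathbb{K}$ be $\mathbb{R}$ or $\mathbb{C}$, let $n\ge 2$, let $\lambda_1,\dots,\lambda_n>1$, and let each $X_i$ be a Banach space over $\mathbb{K}$ that is an $\mathcal{L}_{\infty,\lambda_i}$ space, i.e. every finite-dimensional subspace $E\subset X_i$ is contained in a finite-dimensional subspace $F\subset X_i$ for which there is an isomorphism $v:F\to\ell_\infty^{\dim F}$ with $\|v\|\,\|v^{-1}\|<\lambda_i$. Let $T:X_1\times\dots\times X_n\to\mathbb{K}$ be a continuous $n$-linear form. Then $T$ is $(2;2,\dots,2,\infty)$-summing at the origin, that is, $$\sum_{j=1}^\infty |T(x_j^{(1)},\dots,x_j^{(n)})|^2<\infty$$ whenever $(x_j^{(i)})_j$ is weakly $2$-summable in $X_i$ for $i=1,\dots,n-1$ (i.e. $\sum_j|\varphi(x_j^{(i)})|^2<\infty$ for all $\varphi\in X_i'$) and $(x_j^{(n)})_j$ is bounded in $X_n$. Moreover the dual space $X_n'$ has cotype $2$, and if $n\ge 3$ then $$\|T\|_{as(2;2,\dots,2,\infty)}\le C_2(X_n')\,K_G\,3^{\frac{n-3}{2}}\,\|T\|\prod_{i=1}^n\lambda_i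 .$$ Here $\|T\|_{as(2;2,\dots,2,\infty)}$ is the infimum of all $L>0$ such that $$\Big(\sum_{j=1}^k|T(x_j^{(1)},\dots,x_j^{(n)})|^2\Big)^{1/2}\le L\,\Big(\prod_{i=1}^{n-1}\sup_{\varphi\in X_i',\,\|\varphi\|\le1}\Big(\sum_{j=1}^k|\varphi(x_j^{(i)})|^2\Big)^{1/2}\Big)\max_{j\le k}\|x_j^{(n)}\|$$ for all $k$ and all $x_j^{(i)}\in X_i$; $C_2(X_n')$ is the least $C\ge0$ such that $\big(\sum_{j=1}^k\|y_j\|^2\big)^{1/2}\le C\big(\int_0^1\|\sum_{j=1}^k r_j(t)y_j\|^2\,dt\big)^{1/2}$ for all $k$ and $y_1,\dots,y_k\in X_n'$, where $r_j$ are the Rademacher functions; and $K_G$ is Grothendieck's constant for the field $\mathbb{K}$, i.e. the least $K$ such that $|\sum_{k,l}a_{kl}\langle u_k,w_l\rangle|\le K$ for all vectors $u_k,w_l$ in the unit ball of a Hilbert space over $\mathbb{K}$ and all finite scalar matrices $(a_{kl})$ with $|\sum_{k,l}a_{kl}s_kt_l|\le1$ whenever $|s_k|,|t_l|\le1$. 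-/

import Mathlib

open scoped ENNReal NNReal

noncomputable section

/-- The `ℓ_p` norm (with values in `[0, ∞]`) of a family `x` of vectors, for `0 < p ≤ ∞`:
`(∑ ‖x j‖ ^ p) ^ (1 / p)` for finite `p`, and `sup ‖x j‖` for `p = ∞`.
It is used for finite families as well as for sequences. -/
def ellNorm {ι F : Type*} [NormedAddCommGroup F] (p : ℝ≥0∞) (x : ι → F) : ℝ≥0∞ :=
  if p = ∞ then ⨆ j, ‖x j‖ₑ else (∑' j, ‖x j‖ₑ ^ p.toReal) ^ (1 / p.toReal)

/-- The weak `ℓ_p` norm `‖(x_j)‖_{w,p}`: the supremum over the closed unit ball of the dual space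
of the `ℓ_p` norms of the scalar families `φ (x_j)`. For `p = ∞` this is `sup ‖x_j‖`. -/
def weakEllNorm (𝕜 : Type*) {ι E : Type*} [RCLike 𝕜] [NormedAddCommGroup E] [NormedSpace 𝕜 E]
    (p : ℝ≥0∞) (x : ι → E) : ℝ≥0∞ :=
  ⨆ φ : {φ : StrongDual 𝕜 E // ‖φ‖ ≤ 1}, ellNorm p (fun j => φ.1 (x j))

/-- `(x_j) ∈ ℓ_p^w(E)`: every continuous linear functional maps the sequence into `ℓ_p`.
For `p = ∞` these are the bounded sequences. -/
def IsWeaklySummable (𝕜 : Type*) {E : Type*} [RCLike 𝕜] [NormedAddCommGroup E] [NormedSpace 𝕜 E]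
    (p : ℝ≥0∞) (x : ℕ → E) : Prop :=
  ∀ φ : StrongDual 𝕜 E, Memℓp (fun j => φ (x j)) p

/-- A continuous multilinear mapping `T` is absolutely `(p; q_1, …, q_n)`-summing at the point `a`:
`(T(a_1 + x_j^1, …, a_n + x_j^n) - T(a_1, …, a_n))_j ∈ ℓ_p(F)` whenever
`(x_j^i)_j ∈ ℓ_{q_i}^w(E_i)` for all `i`. -/
def IsSummingAt {𝕜 ι F : Type*} {E : ι → Type*} [RCLike 𝕜] [Fintype ι]
    [∀ i, NormedAddCommGroup (E i)] [∀ i, NormedSpace 𝕜 (E i)]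
    [NormedAddCommGroup F] [NormedSpace 𝕜 F]
    (p : ℝ≥0∞) (q : ι → ℝ≥0∞) (T : ContinuousMultilinearMap 𝕜 E F) (a : ∀ i, E i) : Prop :=
  ∀ x : ∀ i, ℕ → E i, (∀ i, IsWeaklySummable 𝕜 (q i) (x i)) →
    Memℓp (fun j => T (fun i => a i + x i j) - T a) p

/-- The `(p; q_1, …, q_n)`-summing norm (at the origin) of a continuous multilinear mapping: the
infimum of all `L > 0` such that, for all finite families,
`(∑_j ‖T(x_j^1, …, x_j^n)‖^p)^{1/p} ≤ L ∏_i ‖(x_j^i)_j‖_{w,q_i}`; it is `∞` if there is no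
such `L`. -/
def summingNorm {𝕜 ι F : Type*} {E : ι → Type*} [RCLike 𝕜] [Fintype ι]
    [∀ i, NormedAddCommGroup (E i)] [∀ i, NormedSpace 𝕜 (E i)]
    [NormedAddCommGroup F] [NormedSpace 𝕜 F]
    (p : ℝ≥0∞) (q : ι → ℝ≥0∞) (T : ContinuousMultilinearMap 𝕜 E F) : ℝ≥0∞ :=
  ⨅ (L : ℝ≥0) (_ : 0 < L ∧ ∀ (k : ℕ) (x : ∀ i, Fin k → E i),
    ellNorm p (fun j => T (fun i => x i j)) ≤ L * ∏ i, weakEllNorm 𝕜 (q i) (x i)), (L : ℝ≥0∞)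

/-- `X` is an `ℒ_{p,lam}` space (`1 ≤ p ≤ ∞`, `1 < lam`): every finite dimensional subspace `E` is
contained in a finite dimensional subspace `F` that admits an isomorphism `v` onto `ℓ_p^{dim F}`
with `‖v‖ ‖v⁻¹‖ < lam`. -/
def IsScriptLSpace (𝕜 : Type*) [RCLike 𝕜] (p : ℝ≥0∞) [Fact (1 ≤ p)] (lam : ℝ)
    (X : Type*) [NormedAddCommGroup X] [NormedSpace 𝕜 X] : Prop :=
  ∀ E : Submodule 𝕜 X, FiniteDimensional 𝕜 E →
    ∃ F : Submodule 𝕜 X, E ≤ F ∧ FiniteDimensional 𝕜 F ∧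
      ∃ v : F ≃L[𝕜] PiLp p (fun _ : Fin (Module.finrank 𝕜 F) => 𝕜),
        ‖(v : F →L[𝕜] PiLp p (fun _ : Fin (Module.finrank 𝕜 F) => 𝕜))‖ *
          ‖(v.symm : PiLp p (fun _ : Fin (Module.finrank 𝕜 F) => 𝕜) →L[𝕜] F)‖ < lam

/-- The Rademacher functions `r_1, r_2, …` on `[0, 1]`, indexed from `0`: `rademacher j` is
`r_{j+1}(t) = sign (sin (2 ^ (j + 1) π t))`. -/
def rademacher (j : ℕ) (t : ℝ) : ℝ :=
  Real.sign (Real.sin (2 ^ (j + 1) * Real.pi * t))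

/-- `C` is a cotype `q` constant of `E`: for all finite families `x_1, …, x_k` in `E`,
`(∑ ‖x_j‖^q)^{1/q} ≤ C (∫_0^1 ‖∑ r_j(t) x_j‖^2 dt)^{1/2}`, the left side being
`max ‖x_j‖` for `q = ∞`. -/
def IsCotypeConstant (𝕜 : Type*) [RCLike 𝕜] (q : ℝ≥0∞) (E : Type*) [NormedAddCommGroup E]
    [NormedSpace 𝕜 E] (C : ℝ≥0) : Prop :=
  ∀ (k : ℕ) (x : Fin k → E),
    ellNorm q x ≤
      C * ENNReal.ofReal
        (Real.sqrt (∫ t in (0 : ℝ)..1, ‖∑ j : Fin k, ((rademacher (j : ℕ) t : ℝ) : 𝕜) • x j‖ ^ 2))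

/-- `E` has cotype `q` (`2 ≤ q ≤ ∞`). -/
def HasCotype (𝕜 : Type*) [RCLike 𝕜] (q : ℝ≥0∞) (E : Type*) [NormedAddCommGroup E]
    [NormedSpace 𝕜 E] : Prop :=
  ∃ C : ℝ≥0, IsCotypeConstant 𝕜 q E C

/-- The cotype `q` constant `C_q(E)`: the infimum of all cotype `q` constants of `E`
(`∞` if `E` does not have cotype `q`). -/
def cotypeConstant (𝕜 : Type*) [RCLike 𝕜] (q : ℝ≥0∞) (E : Type*) [NormedAddCommGroup E]
    [NormedSpace 𝕜 E] : ℝ≥0∞ :=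
  ⨅ (C : ℝ≥0) (_ : IsCotypeConstant 𝕜 q E C), (C : ℝ≥0∞)

/-- Grothendieck's constant `K_G` for the scalar field `𝕜`: the least `K` such that, for every
scalar matrix `a` with `|∑ a_{kl} s_k t_l| ≤ 1` for all scalars `|s_k| ≤ 1`, `|t_l| ≤ 1`,
one has `|∑ a_{kl} ⟨u_k, w_l⟩| ≤ K` for all vectors `u_k, w_l` in the unit ball of a Hilbert
space. Finitely many vectors span a finite dimensional Hilbert space, so the spaces `𝕜^d` with
the Euclidean norm suffice. -/
def grothendieckConstant (𝕜 : Type*) [RCLike 𝕜] : ℝ :=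
  sInf {K : ℝ | ∀ (m n d : ℕ) (a : Matrix (Fin m) (Fin n) 𝕜),
    (∀ (s : Fin m → 𝕜) (t : Fin n → 𝕜), (∀ k, ‖s k‖ ≤ 1) → (∀ l, ‖t l‖ ≤ 1) →
      ‖∑ k, ∑ l, a k l * (s k * t l)‖ ≤ 1) →
    ∀ (u : Fin m → EuclideanSpace 𝕜 (Fin d)) (w : Fin n → EuclideanSpace 𝕜 (Fin d)),
      (∀ k, ‖u k‖ ≤ 1) → (∀ l, ‖w l‖ ≤ 1) →
      ‖∑ k, ∑ l, a k l * inner 𝕜 (u k) (w l)‖ ≤ K}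

end

/-!
The proof has three ingredients.

*The multilinear Grothendieck inequality.* For an `(m + 2)`-linear form `A` on products of spaces
`ℓ_∞^d` and families `x i j` whose coordinates satisfy `∑ j, ‖x i j l‖ ^ 2 ≤ 1`, the diagonal sums
`∑ j, c j * A (x j)` with `‖c j‖ ≤ 1` are at most `K_G * √3 ^ m * ‖A‖`
(`norm_sum_mul_multilinear_le`). For two variables this is the definition of `K_G`, once one knows
that constants exist at all (`grothendieck_inequality`). Each further variable costs `√3`: replace it
by a Rademacher sum and truncate at height `M`. As the fourth moment is at most three times the
squared second moment, the remainder has `L_2` norm at most `√3 / (4 M)`, so the best constant `S`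
satisfies `S ≤ M D + √3 / (4 M) * S`, where `D` is the constant for one variable less, and
`M = √3 / 2` gives `S ≤ √3 * D`. The same truncation, applied to both variables, proves
Grothendieck's inequality. The definition of script-`ℒ_∞` spaces and the Hahn-Banach theorem transfer
the result to the spaces `X i`, at the cost of the factor `∏ i, lam i`
(`norm_sum_mul_le_of_isScriptLSpace`).

*Summability.* For bounded `x_n` and `t j = T (x j)`, the vectors `conj (t j) • x_n j` have weak
`ℓ_2` norm at most `‖t‖₂ * sup ‖x_n‖`, so the inequality above yields `‖t‖₂ ^ 2 ≤ const * ‖t‖₂`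
(`sum_norm_sq_le_of_isScriptLSpace`).

*Cotype.* Locally, `X_n` looks like `ℓ_∞^d` and its dual like `ℓ_1^d`, which has cotype `2` by
Khinchine's inequality (`IsScriptLSpace.hasCotype_dual`). For `n ≥ 3` the cotype inequality in the
dual of `X_n` reduces the sum of the `‖T (x j, ·)‖ ^ 2` to signed diagonal sums of the
`(n - 1)`-linear forms `T (·, z)`, where the Grothendieck inequality has the exponent `n - 3`
(`ellNorm_two_le_of_isCotypeConstant`).
-/

section

variable {𝕜 : Type*} [RCLike 𝕜]

/-! ### Random signs -/

theorem sum_signs_succ {k : ℕ} {V : Type*} [AddCommMonoid V] (G : (Fin (k + 1) → ℤˣ) → V) :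
    ∑ ω, G ω = ∑ ω : Fin k → ℤˣ, (G (Fin.cons 1 ω) + G (Fin.cons (-1) ω)) := by
  rw [← (Fin.consEquiv (fun _ : Fin (k + 1) => ℤˣ)).sum_comp, Fintype.sum_prod_type,
    show (Finset.univ : Finset ℤˣ) = {1, -1} from rfl, Finset.sum_pair (by decide), ← Finset.sum_add_distrib]
  rfl

/-- The value at the sign pattern `ω` of the Rademacher sum with coefficients `a`. -/
def signSum {k : ℕ} (a : Fin k → 𝕜) (ω : Fin k → ℤˣ) : 𝕜 := ∑ j, ((ω j : ℤ) : 𝕜) * a j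

theorem norm_sign (u : ℤˣ) : ‖((u : ℤ) : 𝕜)‖ = 1 := by
  rcases Int.units_eq_one_or u with rfl | rfl <;> simp

theorem signSum_cons_one {k : ℕ} (a : Fin (k + 1) → 𝕜) (ω : Fin k → ℤˣ) :
    signSum a (Fin.cons 1 ω) = signSum (Fin.tail a) ω + a 0 := by
  simp [signSum, Fin.sum_univ_succ, Fin.tail, add_comm]

theorem signSum_cons_neg_one {k : ℕ} (a : Fin (k + 1) → 𝕜) (ω : Fin k → ℤˣ) :
    signSum a (Fin.cons (-1) ω) = signSum (Fin.tail a) ω - a 0 := by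
  simp [signSum, Fin.sum_univ_succ, Fin.tail]; ring

theorem card_signs (k : ℕ) : Fintype.card (Fin k → ℤˣ) = 2 ^ k := by simp

/-- Orthonormality of independent signs, in bilinear form. -/
theorem sum_signSum_mul_signSum {k : ℕ} (a b : Fin k → 𝕜) :
    ∑ ω, signSum a ω * signSum b ω = 2 ^ k * ∑ j, a j * b j := by
  induction k with
  | zero => simp [signSum]
  | succ k ih =>
    rw [sum_signs_succ]
    simp_rw [signSum_cons_one, signSum_cons_neg_one]
    calc _ = ∑ ω : Fin k → ℤˣ, (2 * (signSum (Fin.tail a) ω * signSum (Fin.tail b) ω)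
          + 2 * (a 0 * b 0)) := Finset.sum_congr rfl fun ω _ => by ring
      _ = _ := by
        rw [Finset.sum_add_distrib, ← Finset.mul_sum, ih, Finset.sum_const, Finset.card_univ,
          card_signs, Fin.sum_univ_succ]
        simp only [Fin.tail, nsmul_eq_mul]
        push_cast
        ring

theorem signSum_single {k : ℕ} (j : Fin k) (ω : Fin k → ℤˣ) :
    signSum (Pi.single j (1 : 𝕜)) ω = ((ω j : ℤ) : 𝕜) := by
  simp [signSum, Pi.single_apply]

/-- The coefficients of a Rademacher sum are recovered by integrating against the signs. -/
theorem sum_sign_mul_signSum {k : ℕ} (a : Fin k → 𝕜) (j : Fin k) :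
    ∑ ω : Fin k → ℤˣ, ((ω j : ℤ) : 𝕜) * signSum a ω = 2 ^ k * a j := by
  have h := sum_signSum_mul_signSum (Pi.single j (1 : 𝕜)) a
  simpa [signSum_single, Pi.single_apply] using h

theorem star_signSum {k : ℕ} (a : Fin k → 𝕜) (ω : Fin k → ℤˣ) :
    star (signSum a ω) = signSum (star a) ω := by
  simp [signSum]

theorem sum_norm_signSum_sq {k : ℕ} (a : Fin k → 𝕜) :
    ∑ ω, ‖signSum a ω‖ ^ 2 = 2 ^ k * ∑ j, ‖a j‖ ^ 2 := by
  have h := sum_signSum_mul_signSum a (star a)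
  simp_rw [← star_signSum, Pi.star_apply, RCLike.star_def, RCLike.mul_conj] at h
  exact_mod_cast h

/-- The fourth moment of a Rademacher sum is at most three times the square of the second one. -/
theorem sum_norm_signSum_pow_four_le {k : ℕ} (a : Fin k → 𝕜) :
    ∑ ω, ‖signSum a ω‖ ^ 4 ≤ 2 ^ k * (3 * (∑ j, ‖a j‖ ^ 2) ^ 2) := by
  induction k with
  | zero => simp [signSum]
  | succ k ih =>
    rw [sum_signs_succ]
    simp_rw [signSum_cons_one, signSum_cons_neg_one]
    set s := ∑ j, ‖Fin.tail a j‖ ^ 2 with hs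
    have key : ∀ z b : 𝕜, ‖z + b‖ ^ 4 + ‖z - b‖ ^ 4
        ≤ 2 * ‖z‖ ^ 4 + 12 * ‖b‖ ^ 2 * ‖z‖ ^ 2 + 2 * ‖b‖ ^ 4 := fun z b => by
      have h1 : ‖z + b‖ ^ 2 = ‖z‖ ^ 2 + 2 * RCLike.re (inner 𝕜 z b) + ‖b‖ ^ 2 :=
        norm_add_sq z b
      have h2 : ‖z - b‖ ^ 2 = ‖z‖ ^ 2 - 2 * RCLike.re (inner 𝕜 z b) + ‖b‖ ^ 2 :=
        norm_sub_sq z b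
      have h3 : |RCLike.re (inner 𝕜 z b)| ≤ ‖z‖ * ‖b‖ :=
        (RCLike.abs_re_le_norm _).trans (norm_inner_le_norm z b)
      have h4 : RCLike.re (inner 𝕜 z b) ^ 2 ≤ (‖z‖ * ‖b‖) ^ 2 := sq_le_sq.2 (by
        rwa [abs_of_nonneg (by positivity : 0 ≤ ‖z‖ * ‖b‖)])
      calc _ = (‖z + b‖ ^ 2) ^ 2 + (‖z - b‖ ^ 2) ^ 2 := by ring
        _ ≤ _ := by rw [h1, h2]; nlinarith
    calc _ ≤ ∑ ω, (2 * ‖signSum (Fin.tail a) ω‖ ^ 4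
            + 12 * ‖a 0‖ ^ 2 * ‖signSum (Fin.tail a) ω‖ ^ 2 + 2 * ‖a 0‖ ^ 4) :=
          Finset.sum_le_sum fun ω _ => key _ _
      _ = 2 * ∑ ω, ‖signSum (Fin.tail a) ω‖ ^ 4 + 12 * ‖a 0‖ ^ 2 * (2 ^ k * s)
            + 2 ^ k * (2 * ‖a 0‖ ^ 4) := by
          rw [Finset.sum_add_distrib, Finset.sum_add_distrib, ← Finset.mul_sum, ← Finset.mul_sum,
            sum_norm_signSum_sq, Finset.sum_const, Finset.card_univ, card_signs]
          simp [hs]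
      _ ≤ 2 * (2 ^ k * (3 * s ^ 2)) + 12 * ‖a 0‖ ^ 2 * (2 ^ k * s)
            + 2 ^ k * (2 * ‖a 0‖ ^ 4) := by gcongr; exact ih _
      _ ≤ _ := by
          have : ∑ j, ‖a j‖ ^ 2 = s + ‖a 0‖ ^ 2 := by
            rw [Fin.sum_univ_succ, add_comm]; rfl
          have h0 : (0 : ℝ) ≤ 2 ^ k * ‖a 0‖ ^ 4 := by positivity
          rw [this, pow_succ 2 k]
          linarith

/-- Khinchine's inequality in `L_1`, with a constant that comes from the pointwise bound
`(3 / 4) t ^ 2 ≤ t + t ^ 4 / 16` and the second and fourth moments. -/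
theorem sqrt_le_sum_norm_signSum {k : ℕ} (a : Fin k → 𝕜) :
    2 ^ k * √(∑ j, ‖a j‖ ^ 2) ≤ 2 * ∑ ω, ‖signSum a ω‖ := by
  set s := √(∑ j, ‖a j‖ ^ 2) with hs
  have hs2 : s ^ 2 = ∑ j, ‖a j‖ ^ 2 := Real.sq_sqrt (by positivity)
  rcases (Real.sqrt_nonneg _ : 0 ≤ s).eq_or_lt with h0 | h0
  · rw [hs, ← h0, mul_zero]; positivity
  have h2 := sum_norm_signSum_sq a
  have h4 := sum_norm_signSum_pow_four_le a
  rw [← hs2] at h2 h4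
  have key : ∀ t : ℝ, 0 ≤ t → 3 / 4 * s ^ 2 * t ^ 2 ≤ s ^ 3 * t + t ^ 4 / 16 := fun t ht => by
    have : s ^ 3 * t + t ^ 4 / 16 - 3 / 4 * s ^ 2 * t ^ 2
        = t * (t + 4 * s) * (t - 2 * s) ^ 2 / 16 := by ring
    have : 0 ≤ t * (t + 4 * s) * (t - 2 * s) ^ 2 / 16 := by positivity
    linarith
  have h := Finset.sum_le_sum fun ω (_ : ω ∈ Finset.univ) => key ‖signSum a ω‖ (norm_nonneg _)
  rw [Finset.sum_add_distrib, ← Finset.mul_sum, ← Finset.mul_sum, ← Finset.sum_div, h2] at h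
  have hA : s ^ 3 * (2 ^ k * s) ≤ s ^ 3 * (2 * ∑ ω, ‖signSum a ω‖) := by
    have : (0 : ℝ) ≤ 2 ^ k * s ^ 4 := by positivity
    nlinarith
  exact le_of_mul_le_mul_left hA (by positivity)

/-- Bessel's inequality for the orthonormal system of the signs. -/
theorem sum_norm_sum_sign_mul_sq_le {k : ℕ} (h : (Fin k → ℤˣ) → 𝕜) :
    ∑ j, ‖∑ ω, ((ω j : ℤ) : 𝕜) * h ω‖ ^ 2 ≤ 2 ^ k * ∑ ω, ‖h ω‖ ^ 2 := by
  set c : Fin k → 𝕜 := fun j => ∑ ω, ((ω j : ℤ) : 𝕜) * h ω with hc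
  set S := ∑ j, ‖c j‖ ^ 2 with hS
  have hS0 : 0 ≤ S := by positivity
  have e1 : ((S : ℝ) : 𝕜) = ∑ ω, h ω * signSum (star c) ω := by
    simp only [signSum, Finset.mul_sum]
    rw [Finset.sum_comm, hS]
    push_cast
    refine Finset.sum_congr rfl fun j _ => ?_
    rw [← RCLike.mul_conj]
    nth_rw 1 [hc]
    rw [Finset.sum_mul]
    refine Finset.sum_congr rfl fun ω _ => ?_
    simp only [Pi.star_apply, RCLike.star_def]; ring
  have e2 : S ≤ ∑ ω, ‖h ω‖ * ‖signSum (star c) ω‖ := by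
    calc S = ‖((S : ℝ) : 𝕜)‖ := by simp [abs_of_nonneg hS0]
      _ ≤ _ := by
        rw [e1]
        exact (norm_sum_le _ _).trans_eq (Finset.sum_congr rfl fun _ _ => norm_mul _ _)
  have e3 := Finset.sum_mul_sq_le_sq_mul_sq Finset.univ (fun ω => ‖h ω‖)
    (fun ω => ‖signSum (star c) ω‖)
  rw [sum_norm_signSum_sq] at e3
  simp only [Pi.star_apply, norm_star] at e3
  rw [← hS] at e3
  have e4 : S * S ≤ S * (2 ^ k * ∑ ω, ‖h ω‖ ^ 2) := by nlinarith
  rcases hS0.eq_or_lt with h0 | h0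
  · rw [← h0]; positivity
  · exact le_of_mul_le_mul_left e4 h0

theorem exists_truncation {M : ℝ} (hM : 0 < M) (z : 𝕜) :
    ∃ g : 𝕜, ‖g‖ ≤ M ∧ ‖g‖ ≤ ‖z‖ ∧ ‖z - g‖ ≤ ‖z‖ ^ 2 / (4 * M) := by
  rcases le_or_gt ‖z‖ M with h | h
  · exact ⟨z, h, le_rfl, by simp; positivity⟩
  · have hz : 0 < ‖z‖ := hM.trans h
    have e : ‖((M / ‖z‖ : ℝ) : 𝕜) * z‖ = M := by
      rw [norm_mul, RCLike.norm_ofReal, abs_of_pos (by positivity)]; field_simp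
    refine ⟨((M / ‖z‖ : ℝ) : 𝕜) * z, e.le, e.le.trans h.le, ?_⟩
    have e' : z - ((M / ‖z‖ : ℝ) : 𝕜) * z = ((1 - M / ‖z‖ : ℝ) : 𝕜) * z := by
      push_cast; ring
    have : M / ‖z‖ ≤ 1 := (div_le_one hz).2 h.le
    rw [e', norm_mul, RCLike.norm_ofReal, abs_of_nonneg (by linarith), sub_mul,
      div_mul_cancel₀ _ hz.ne', le_div_iff₀ (by positivity)]
    nlinarith [sq_nonneg (‖z‖ - 2 * M)]

/-- Truncating a normalized Rademacher sum at height `M` costs at most `√3 / (4 M)` in `L_2`; this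
is where the fourth moment enters. -/
theorem exists_truncation_signSum {k : ℕ} {M : ℝ} (hM : 0 < M) (a : Fin k → 𝕜)
    (ha : ∑ j, ‖a j‖ ^ 2 ≤ 1) :
    ∃ g : (Fin k → ℤˣ) → 𝕜, (∀ ω, ‖g ω‖ ≤ M) ∧ (∀ ω, ‖g ω‖ ≤ ‖signSum a ω‖) ∧
      ∑ ω, ‖signSum a ω - g ω‖ ^ 2 ≤ 2 ^ k * (3 / (16 * M ^ 2)) := by
  choose g h1 h2 h3 using fun ω => exists_truncation hM (signSum a ω)
  refine ⟨g, h1, h2, ?_⟩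
  calc ∑ ω, ‖signSum a ω - g ω‖ ^ 2 ≤ ∑ ω, (‖signSum a ω‖ ^ 2 / (4 * M)) ^ 2 := by
        gcongr with ω; exact h3 ω
    _ = (∑ ω, ‖signSum a ω‖ ^ 4) / (16 * M ^ 2) := by
        rw [Finset.sum_div]; congr! 1; ring
    _ ≤ (2 ^ k * (3 * (∑ j, ‖a j‖ ^ 2) ^ 2)) / (16 * M ^ 2) := by
        gcongr; exact sum_norm_signSum_pow_four_le a
    _ ≤ (2 ^ k * (3 * 1 ^ 2)) / (16 * M ^ 2) := by gcongr
    _ = _ := by ring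

/-! ### Rademacher functions on the unit interval -/

theorem measurable_rademacher (j : ℕ) : Measurable (rademacher j) := by
  have hs : Measurable Real.sign := by
    unfold Real.sign
    exact Measurable.ite measurableSet_Iio measurable_const
      (Measurable.ite measurableSet_Ioi measurable_const measurable_const)
  exact hs.comp (by fun_prop)

theorem abs_rademacher_le_one (j : ℕ) (t : ℝ) : |rademacher j t| ≤ 1 := by
  unfold rademacher
  rcases Real.sign_apply_eq (Real.sin (2 ^ (j + 1) * Real.pi * t)) with h | h | h <;> simp [h]

theorem rademacher_succ (j : ℕ) (t : ℝ) : rademacher (j + 1) t = rademacher j (2 * t) := by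
  unfold rademacher; congr 2; ring

theorem rademacher_periodic (j : ℕ) : Function.Periodic (rademacher j) 1 := fun t => by
  unfold rademacher
  have : 2 ^ (j + 1) * Real.pi * (t + 1)
      = 2 ^ (j + 1) * Real.pi * t + ((2 ^ j : ℕ) : ℝ) * (2 * Real.pi) := by
    push_cast; ring
  rw [this, Real.sin_add_nat_mul_two_pi]

theorem rademacher_zero_of_mem_left {t : ℝ} (ht : t ∈ Set.Ioo (0 : ℝ) (1 / 2)) :
    rademacher 0 t = 1 := by
  refine Real.sign_of_pos (Real.sin_pos_of_pos_of_lt_pi ?_ ?_)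
  · have := ht.1; have := Real.pi_pos; positivity
  · have := ht.2; have := Real.pi_pos; norm_num; nlinarith

theorem rademacher_zero_of_mem_right {t : ℝ} (ht : t ∈ Set.Ioo (1 / 2 : ℝ) 1) :
    rademacher 0 t = -1 := by
  refine Real.sign_of_neg ?_
  have : 2 ^ (0 + 1) * Real.pi * t = (2 * t - 1) * Real.pi + Real.pi := by ring
  rw [this, Real.sin_add_pi, neg_lt_zero]
  have h1 := ht.1; have h2 := ht.2; have := Real.pi_pos
  refine Real.sin_pos_of_pos_of_lt_pi ?_ ?_ <;> nlinarith

theorem intervalIntegrable_comp_rademacher {k : ℕ} {G : (Fin k → ℝ) → ℝ} (hG : Continuous G)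
    (u v : ℝ) : IntervalIntegrable (fun t => G fun j => rademacher j t) MeasureTheory.volume u v := by
  obtain ⟨C, hC⟩ := (isCompact_closedBall (0 : Fin k → ℝ) 1).exists_bound_of_continuousOn
    hG.continuousOn
  have hm : Measurable fun t => G fun j : Fin k => rademacher j t :=
    hG.measurable.comp (measurable_pi_lambda _ fun j => measurable_rademacher j)
  have hb : ∀ t, ‖G fun j : Fin k => rademacher j t‖ ≤ C := fun t => hC _ (by
    rw [mem_closedBall_zero_iff, pi_norm_le_iff_of_nonneg zero_le_one]
    exact fun j => abs_rademacher_le_one j t)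
  rw [intervalIntegrable_iff]
  exact MeasureTheory.Measure.integrableOn_of_bounded (M := C) (by simp) hm.aestronglyMeasurable
    (Filter.Eventually.of_forall hb)

/-- The Rademacher functions are independent uniformly distributed signs: integrating a function
of the first `k` of them amounts to averaging over all sign patterns. By induction, as
`r_{j+1}(t) = r_j(2t)` and `r_j` has period one. -/
theorem integral_comp_rademacher {k : ℕ} {G : (Fin k → ℝ) → ℝ} (hG : Continuous G) :
    2 ^ k * ∫ t in (0 : ℝ)..1, G (fun j => rademacher j t)
      = ∑ ω : Fin k → ℤˣ, G fun j => ((ω j : ℤ) : ℝ) := by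
  induction k with
  | zero =>
    simp [Subsingleton.elim (fun j : Fin 0 => (rademacher _ _ : ℝ)) (fun j => 0)]
    congr 1; exact Subsingleton.elim _ _
  | succ k ih =>
    have hc : ∀ a : ℝ, Continuous fun v : Fin k → ℝ => G (Fin.cons a v) := fun a =>
      hG.comp (Continuous.finCons continuous_const continuous_id)
    have hsplit : ∀ t, (fun j : Fin (k + 1) => rademacher j t)
        = Fin.cons (rademacher 0 t) fun j : Fin k => rademacher j (2 * t) := fun t => by
      funext j
      refine Fin.cases ?_ (fun j => ?_) j
      · rfl
      · simp [rademacher_succ]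
    have h1 : ∫ t in (0 : ℝ)..(1 / 2), G (fun j => rademacher j t)
        = 2⁻¹ * ∫ t in (0 : ℝ)..1, G (Fin.cons 1 fun j : Fin k => rademacher j t) := by
      have := intervalIntegral.integral_comp_mul_left (a := 0) (b := 1 / 2)
        (fun t => G (Fin.cons 1 fun j : Fin k => rademacher j t)) (two_ne_zero (α := ℝ))
      norm_num at this
      norm_num
      rw [← this]
      refine intervalIntegral.integral_congr_Ioo_of_le (by norm_num) fun t ht => ?_
      simp only [hsplit]
      rw [rademacher_zero_of_mem_left (by simpa using ht)]
    have h2 : ∫ t in (1 / 2 : ℝ)..1, G (fun j => rademacher j t)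
        = 2⁻¹ * ∫ t in (0 : ℝ)..1, G (Fin.cons (-1) fun j : Fin k => rademacher j t) := by
      have := intervalIntegral.integral_comp_mul_left (a := 1 / 2) (b := 1)
        (fun t => G (Fin.cons (-1) fun j : Fin k => rademacher j t)) (two_ne_zero (α := ℝ))
      have hp : Function.Periodic
          (fun t => G (Fin.cons (-1) fun j : Fin k => rademacher j t)) 1 := fun t => by
        simp only [rademacher_periodic _ t]
      have hp' := hp.intervalIntegral_add_eq 1 0
      norm_num at this hp'
      norm_num
      rw [← hp', ← this]
      refine intervalIntegral.integral_congr_Ioo_of_le (by norm_num) fun t ht => ?_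
      simp only [hsplit]
      rw [rademacher_zero_of_mem_right (by simpa using ht)]
    rw [← intervalIntegral.integral_add_adjacent_intervals
      (intervalIntegrable_comp_rademacher hG 0 (1 / 2))
      (intervalIntegrable_comp_rademacher hG (1 / 2) 1), h1, h2, sum_signs_succ,
      Finset.sum_add_distrib]
    have e : ∀ (u : ℤˣ) (ω : Fin k → ℤˣ),
        (fun j : Fin (k + 1) => (((Fin.cons u ω : Fin (k + 1) → ℤˣ) j : ℤ) : ℝ))
          = Fin.cons ((u : ℤ) : ℝ) fun j => ((ω j : ℤ) : ℝ) := fun u ω => by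
      funext j
      refine Fin.cases ?_ (fun j => ?_) j <;> simp
    simp_rw [e]
    have i1 := ih (hc 1)
    have i2 := ih (hc (-1))
    simp only [Units.val_one, Units.val_neg, Int.cast_one, Int.cast_neg]
    rw [← i1, ← i2]
    ring

/-! ### Grothendieck's inequality -/

/-- A bounded set of reals whose upper bounds `B` can always be improved to `D + θ * B` is bounded
by `D / (1 - θ)`: apply the hypothesis to the supremum. -/
theorem le_div_of_forall_improve {S : Set ℝ} (hS : BddAbove S) {D θ : ℝ} (hθ : θ < 1)
    (h : ∀ B, (∀ r ∈ S, r ≤ B) → ∀ r ∈ S, r ≤ D + θ * B) : ∀ r ∈ S, r ≤ D / (1 - θ) := by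
  intro r hr
  have h1 : sSup S ≤ D + θ * sSup S :=
    csSup_le ⟨r, hr⟩ (h _ fun r hr => le_csSup hS hr)
  have h2 : sSup S ≤ D / (1 - θ) := by
    rw [le_div_iff₀ (by linarith)]; linarith
  exact (le_csSup hS hr).trans h2

/-- The sum `∑ a_{kl} ⟨u_k, w_l⟩`, with the bilinear pairing of coordinates in place of the inner
product. -/
def matrixPairing {m n : ℕ} (a : Matrix (Fin m) (Fin n) 𝕜) {J : Type*} [Fintype J]
    (u : Fin m → J → 𝕜) (w : Fin n → J → 𝕜) : 𝕜 :=
  ∑ k, ∑ l, a k l * ∑ j, u k j * w l j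

theorem matrixPairing_add_left {m n : ℕ} (a : Matrix (Fin m) (Fin n) 𝕜) {J : Type*} [Fintype J]
    (u u' : Fin m → J → 𝕜) (w : Fin n → J → 𝕜) :
    matrixPairing a (u + u') w = matrixPairing a u w + matrixPairing a u' w := by
  simp only [matrixPairing, Pi.add_apply, add_mul, Finset.sum_add_distrib, mul_add]

theorem matrixPairing_add_right {m n : ℕ} (a : Matrix (Fin m) (Fin n) 𝕜) {J : Type*} [Fintype J]
    (u : Fin m → J → 𝕜) (w w' : Fin n → J → 𝕜) :
    matrixPairing a u (w + w') = matrixPairing a u w + matrixPairing a u w' := by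
  simp only [matrixPairing, Pi.add_apply, Finset.sum_add_distrib, mul_add]

theorem matrixPairing_eq_sum {m n : ℕ} (a : Matrix (Fin m) (Fin n) 𝕜) {J : Type*} [Fintype J]
    (u : Fin m → J → 𝕜) (w : Fin n → J → 𝕜) :
    matrixPairing a u w = ∑ j, ∑ k, ∑ l, a k l * (u k j * w l j) := by
  simp only [matrixPairing, Finset.mul_sum]
  rw [Finset.sum_comm (s := (Finset.univ : Finset J))]
  exact Finset.sum_congr rfl fun k _ => Finset.sum_comm

/-- Fields of bounded vectors over a finite index set pair as the scalar bilinear form does. -/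
theorem norm_matrixPairing_le_of_bounded {m n : ℕ} {a : Matrix (Fin m) (Fin n) 𝕜}
    (ha : ∀ (s : Fin m → 𝕜) (t : Fin n → 𝕜), (∀ k, ‖s k‖ ≤ 1) → (∀ l, ‖t l‖ ≤ 1) →
      ‖∑ k, ∑ l, a k l * (s k * t l)‖ ≤ 1)
    {J : Type*} [Fintype J] {M : ℝ} (hM : 0 < M)
    (u : Fin m → J → 𝕜) (w : Fin n → J → 𝕜) (hu : ∀ k j, ‖u k j‖ ≤ M)
    (hw : ∀ l j, ‖w l j‖ ≤ M) : ‖matrixPairing a u w‖ ≤ Fintype.card J * M ^ 2 := by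
  rw [matrixPairing_eq_sum]
  refine (norm_sum_le _ _).trans ((Finset.sum_le_card_nsmul _ _ (M ^ 2) fun j _ => ?_).trans_eq
    (by simp))
  have hM' : (M : 𝕜) ≠ 0 := by exact_mod_cast hM.ne'
  have hn : ‖(M : 𝕜)‖ = M := by simp [abs_of_pos hM]
  have e : ∑ k, ∑ l, a k l * (u k j * w l j)
      = (M : 𝕜) ^ 2 * ∑ k, ∑ l, a k l * ((M : 𝕜)⁻¹ * u k j * ((M : 𝕜)⁻¹ * w l j)) := by
    simp only [Finset.mul_sum]
    congr! 2
    field_simp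
  rw [e, norm_mul, norm_pow, hn]
  refine mul_le_of_le_one_right (by positivity) (ha _ _ (fun k => ?_) fun l => ?_)
  · rw [norm_mul, norm_inv, hn, inv_mul_le_one₀ hM]; exact hu k j
  · rw [norm_mul, norm_inv, hn, inv_mul_le_one₀ hM]; exact hw l j

/-- The values `‖∑ a_{kl} ⟨u_k, w_l⟩‖` for vectors in the unit balls of the spaces `𝕜 ^ d`. -/
def pairingValues {m n : ℕ} (a : Matrix (Fin m) (Fin n) 𝕜) : Set ℝ :=
  {r | ∃ (d : ℕ) (u : Fin m → Fin d → 𝕜) (w : Fin n → Fin d → 𝕜),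
    (∀ k, ∑ j, ‖u k j‖ ^ 2 ≤ 1) ∧ (∀ l, ∑ j, ‖w l j‖ ^ 2 ≤ 1) ∧ ‖matrixPairing a u w‖ = r}

theorem norm_matrixPairing_le_of_values_le {m n : ℕ} {a : Matrix (Fin m) (Fin n) 𝕜} {B : ℝ}
    (hB : ∀ r ∈ pairingValues a, r ≤ B) {J : Type*} [Fintype J] {α β : ℝ} (hα : 0 < α)
    (hβ : 0 < β) (u : Fin m → J → 𝕜) (w : Fin n → J → 𝕜)
    (hu : ∀ k, ∑ j, ‖u k j‖ ^ 2 ≤ α ^ 2) (hw : ∀ l, ∑ j, ‖w l j‖ ^ 2 ≤ β ^ 2) :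
    ‖matrixPairing a u w‖ ≤ α * β * B := by
  let e := Fintype.equivFin J
  have hα' : (α : 𝕜) ≠ 0 := by exact_mod_cast hα.ne'
  have hβ' : (β : 𝕜) ≠ 0 := by exact_mod_cast hβ.ne'
  have hnα : ‖(α : 𝕜)‖ = α := by simp [abs_of_pos hα]
  have hnβ : ‖(β : 𝕜)‖ = β := by simp [abs_of_pos hβ]
  have h := hB _ ⟨_, fun k j => (α : 𝕜)⁻¹ * u k (e.symm j), fun l j => (β : 𝕜)⁻¹ * w l (e.symm j),
    fun k => ?_, fun l => ?_, rfl⟩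
  · have he : matrixPairing a u w = (α * β : 𝕜) * matrixPairing a
        (fun k j => (α : 𝕜)⁻¹ * u k (e.symm j)) (fun l j => (β : 𝕜)⁻¹ * w l (e.symm j)) := by
      simp only [matrixPairing, Finset.mul_sum]
      congr! 2 with k _ l _
      rw [← e.symm.sum_comp]
      congr! 1
      field_simp
    rw [he, norm_mul, norm_mul, hnα, hnβ]
    gcongr
  · rw [e.symm.sum_comp (fun j => ‖(α : 𝕜)⁻¹ * u k j‖ ^ 2)]
    simp only [norm_mul, norm_inv, hnα, mul_pow, ← Finset.mul_sum]
    rw [inv_pow, inv_mul_le_one₀ (by positivity)]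
    exact hu k
  · rw [e.symm.sum_comp (fun j => ‖(β : 𝕜)⁻¹ * w l j‖ ^ 2)]
    simp only [norm_mul, norm_inv, hnβ, mul_pow, ← Finset.mul_sum]
    rw [inv_pow, inv_mul_le_one₀ (by positivity)]
    exact hw l

theorem bddAbove_pairingValues {m n : ℕ} (a : Matrix (Fin m) (Fin n) 𝕜) :
    BddAbove (pairingValues a) := by
  refine ⟨∑ k, ∑ l, ‖a k l‖, ?_⟩
  rintro r ⟨d, u, w, hu, hw, rfl⟩
  refine (norm_sum_le _ _).trans (Finset.sum_le_sum fun k _ => (norm_sum_le _ _).trans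
    (Finset.sum_le_sum fun l _ => ?_))
  rw [norm_mul]
  refine mul_le_of_le_one_right (norm_nonneg _) ?_
  have h1 : ‖∑ j, u k j * w l j‖ ≤ ∑ j, ‖u k j‖ * ‖w l j‖ :=
    (norm_sum_le _ _).trans_eq (Finset.sum_congr rfl fun _ _ => norm_mul _ _)
  have h2 := Finset.sum_mul_sq_le_sq_mul_sq Finset.univ (fun j => ‖u k j‖) (fun j => ‖w l j‖)
  have h3 : (∑ j, ‖u k j‖ ^ 2) * ∑ j, ‖w l j‖ ^ 2 ≤ 1 :=
    mul_le_one₀ (hu k) (by positivity) (hw l)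
  exact h1.trans ((sq_le_one_iff₀ (by positivity)).1 (h2.trans h3))

/-- Grothendieck's inequality. The vectors `u_k`, `w_l` are replaced by Rademacher sums with
coefficients `u_k`, `w_l`; both are truncated at height `2`, and the remainders have `L_2` norm at
most `1 / 4`, which improves any given bound `B` to `4 + B / 2`. -/
theorem grothendieck_inequality {m n : ℕ} {a : Matrix (Fin m) (Fin n) 𝕜}
    (ha : ∀ (s : Fin m → 𝕜) (t : Fin n → 𝕜), (∀ k, ‖s k‖ ≤ 1) → (∀ l, ‖t l‖ ≤ 1) →
      ‖∑ k, ∑ l, a k l * (s k * t l)‖ ≤ 1) :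
    ∀ r ∈ pairingValues a, r ≤ 8 := by
  have key := le_div_of_forall_improve (bddAbove_pairingValues a) (D := 4) (θ := 1 / 2)
    (by norm_num) ?_
  · intro r hr; exact (key r hr).trans (by norm_num)
  rintro B hB r ⟨d, u, w, hu, hw, rfl⟩
  choose g hgM hgf hg using fun k => exists_truncation_signSum (two_pos (α := ℝ)) (u k) (hu k)
  choose g' hgM' hgf' hg' using fun l => exists_truncation_signSum (two_pos (α := ℝ)) (w l) (hw l)
  set φ : Fin m → (Fin d → ℤˣ) → 𝕜 := fun k => signSum (u k) with hφ
  set ψ : Fin n → (Fin d → ℤˣ) → 𝕜 := fun l => signSum (w l) with hψ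
  obtain ⟨c, hc, hc2⟩ : ∃ c : ℝ, 0 < c ∧ c ^ 2 = 2 ^ d := ⟨√(2 ^ d), by positivity,
    Real.sq_sqrt (by positivity)⟩
  have e1 : matrixPairing a φ ψ = 2 ^ d * matrixPairing a u w := by
    simp only [matrixPairing, hφ, hψ, sum_signSum_mul_signSum, Finset.mul_sum]
    congr! 3
    ring
  have e2 : matrixPairing a φ ψ
      = matrixPairing a g g' + matrixPairing a (φ - g) ψ + matrixPairing a g (ψ - g') := by
    have h1 := matrixPairing_add_left a g (φ - g) ψ
    have h2 := matrixPairing_add_right a g g' (ψ - g')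
    rw [add_sub_cancel] at h1 h2
    rw [h1, h2]; ring
  have n1 : ‖matrixPairing a g g'‖ ≤ 2 ^ d * 4 := by
    refine (norm_matrixPairing_le_of_bounded ha two_pos g g' hgM hgM').trans_eq ?_
    rw [card_signs]; norm_num
  have hφ2 : ∀ k, ∑ ω, ‖g k ω‖ ^ 2 ≤ c ^ 2 := fun k => by
    calc ∑ ω, ‖g k ω‖ ^ 2 ≤ ∑ ω, ‖signSum (u k) ω‖ ^ 2 := by gcongr with ω; exact hgf k ω
      _ ≤ c ^ 2 := by
        rw [sum_norm_signSum_sq, hc2]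
        exact mul_le_of_le_one_right (by positivity) (hu k)
  have hψ2 : ∀ l, ∑ ω, ‖ψ l ω‖ ^ 2 ≤ c ^ 2 := fun l => by
    rw [hψ, sum_norm_signSum_sq, hc2]
    exact mul_le_of_le_one_right (by positivity) (hw l)
  have hsmall : (2 : ℝ) ^ d * (3 / (16 * 2 ^ 2)) ≤ (c / 4) ^ 2 := by
    rw [div_pow, hc2]
    have : (0 : ℝ) < 2 ^ d := by positivity
    linarith
  have n2 : ‖matrixPairing a (φ - g) ψ‖ ≤ c / 4 * c * B :=
    norm_matrixPairing_le_of_values_le hB (by positivity) hc _ _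
      (fun k => (hg k).trans hsmall) hψ2
  have n3 : ‖matrixPairing a g (ψ - g')‖ ≤ c * (c / 4) * B :=
    norm_matrixPairing_le_of_values_le hB hc (by positivity) _ _
      hφ2 (fun l => (hg' l).trans hsmall)
  have n4 : 2 ^ d * ‖matrixPairing a u w‖ ≤ 2 ^ d * (4 + 1 / 2 * B) := by
    calc 2 ^ d * ‖matrixPairing a u w‖ = ‖matrixPairing a φ ψ‖ := by
          rw [e1, norm_mul, norm_pow, RCLike.norm_ofNat]
      _ ≤ 2 ^ d * 4 + c / 4 * c * B + c * (c / 4) * B := by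
          rw [e2]
          exact (norm_add₃_le).trans (by gcongr)
      _ = _ := by rw [← hc2]; ring
  exact le_of_mul_le_mul_left n4 (by positivity)

variable (𝕜) in
theorem grothendieckConstant_nonneg : 0 ≤ grothendieckConstant 𝕜 := by
  refine Real.sInf_nonneg fun K hK => ?_
  simpa using hK 0 0 0 0 (by simp) 0 0 (by simp) (by simp)

/-- Grothendieck's constant is itself a constant in Grothendieck's inequality: the set of
constants is not empty, so that its infimum is genuine. -/
theorem norm_matrixPairing_le_grothendieckConstant {m n d : ℕ} {a : Matrix (Fin m) (Fin n) 𝕜}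
    (ha : ∀ (s : Fin m → 𝕜) (t : Fin n → 𝕜), (∀ k, ‖s k‖ ≤ 1) → (∀ l, ‖t l‖ ≤ 1) →
      ‖∑ k, ∑ l, a k l * (s k * t l)‖ ≤ 1)
    (u : Fin m → Fin d → 𝕜) (w : Fin n → Fin d → 𝕜)
    (hu : ∀ k, ∑ j, ‖u k j‖ ^ 2 ≤ 1) (hw : ∀ l, ∑ j, ‖w l j‖ ^ 2 ≤ 1) :
    ‖matrixPairing a u w‖ ≤ grothendieckConstant 𝕜 := by
  refine le_csInf ⟨8, ?_⟩ fun K hK => ?_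
  · intro m n d a ha u w hu hw
    refine grothendieck_inequality ha _ ⟨d, fun k j => star (u k j), fun l j => w l j,
      fun k => ?_, fun l => ?_, ?_⟩
    · simpa [EuclideanSpace.norm_eq] using hu k
    · simpa [EuclideanSpace.norm_eq] using hw l
    · simp [matrixPairing, PiLp.inner_apply, mul_comm]
  · have := hK m n d a ha (fun k => WithLp.toLp 2 (star (u k))) (fun l => WithLp.toLp 2 (w l))
      (fun k => by simpa [EuclideanSpace.norm_eq] using hu k)
      (fun l => by simpa [EuclideanSpace.norm_eq] using hw l)
    simpa [matrixPairing, PiLp.inner_apply, mul_comm] using this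

/-! ### Multilinear forms on `ℓ_∞^d` -/

theorem MultilinearMap.apply_eq_sum_of_fin_two {d : Fin 2 → ℕ}
    (A : MultilinearMap 𝕜 (fun i => Fin (d i) → 𝕜) 𝕜) (x : ∀ i, Fin (d i) → 𝕜) :
    A x = ∑ k, ∑ l, A (fun i => Pi.single ((piFinTwoEquiv fun i => Fin (d i)).symm (k, l) i) 1) *
      (x 0 k * x 1 l) := by
  have h : x = fun i => ∑ l, x i l • (Pi.single l 1 : Fin (d i) → 𝕜) := by
    funext i
    exact pi_eq_sum_univ' (x i)
  conv_lhs => rw [h]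
  rw [A.map_sum, ← (piFinTwoEquiv fun i => Fin (d i)).symm.sum_comp, Fintype.sum_prod_type]
  refine Finset.sum_congr rfl fun k _ => Finset.sum_congr rfl fun l _ => ?_
  rw [A.map_smul_univ (fun i => x i ((piFinTwoEquiv fun i => Fin (d i)).symm (k, l) i)),
    Fin.prod_univ_two, smul_eq_mul, mul_comm]
  rfl

/-- For bilinear forms the diagonal sums are estimated by Grothendieck's inequality. -/
theorem norm_sum_mul_bilinear_le {d : Fin 2 → ℕ}
    (A : MultilinearMap 𝕜 (fun i => Fin (d i) → 𝕜) 𝕜) {C : ℝ} (hC : 0 ≤ C)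
    (hA : ∀ s, ‖A s‖ ≤ C * ∏ i, ‖s i‖) {k : ℕ} (c : Fin k → 𝕜) (hc : ∀ j, ‖c j‖ ≤ 1)
    (x : ∀ i, Fin k → Fin (d i) → 𝕜) (hx : ∀ i l, ∑ j, ‖x i j l‖ ^ 2 ≤ 1) :
    ‖∑ j, c j * A (fun i => x i j)‖ ≤ C * grothendieckConstant 𝕜 := by
  rcases hC.eq_or_lt with rfl | hC
  · have : ∀ s, A s = 0 := fun s => by simpa using hA s
    simp [this]
  have hC' : (C : 𝕜) ≠ 0 := by exact_mod_cast hC.ne'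
  have hn : ‖(C : 𝕜)‖ = C := by simp [abs_of_pos hC]
  set a : Matrix (Fin (d 0)) (Fin (d 1)) 𝕜 := fun k l => (C : 𝕜)⁻¹ *
    A (fun i => Pi.single ((piFinTwoEquiv fun i => Fin (d i)).symm (k, l) i) 1) with ha
  have hAa : ∀ v, A v = C * ∑ k, ∑ l, a k l * (v 0 k * v 1 l) := fun v => by
    rw [A.apply_eq_sum_of_fin_two]
    simp only [ha, Finset.mul_sum]
    congr! 2
    field_simp
  have h := norm_matrixPairing_le_grothendieckConstant (a := a) ?_
    (fun l j => c j * x 0 j l) (fun l j => x 1 j l) (fun l => ?_) (hx 1)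
  · have e : ∑ j, c j * A (fun i => x i j)
        = C * matrixPairing a (fun l j => c j * x 0 j l) (fun l j => x 1 j l) := by
      rw [matrixPairing_eq_sum, Finset.mul_sum]
      refine Finset.sum_congr rfl fun j _ => ?_
      rw [hAa]
      simp only [Finset.mul_sum]
      congr! 2
      ring
    rw [e, norm_mul, hn]
    gcongr
  · intro s t hs ht
    have := hA ((piFinTwoEquiv fun i => Fin (d i) → 𝕜).symm (s, t))
    rw [hAa, Fin.prod_univ_two, norm_mul, hn] at this
    refine le_trans (le_of_mul_le_mul_left this hC) (mul_le_one₀ ?_ (norm_nonneg _) ?_)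
    · exact (pi_norm_le_iff_of_nonneg zero_le_one).2 hs
    · exact (pi_norm_le_iff_of_nonneg zero_le_one).2 ht
  · refine le_trans (Finset.sum_le_sum fun j _ => ?_) (hx 0 l)
    rw [norm_mul]
    gcongr
    exact mul_le_of_le_one_left (norm_nonneg _) (hc j)

/-- Passing from `m + 2` to `m + 3` variables costs a factor `√3`. Freeze all variables but the
first, and let `L j` be the resulting linear forms; the first variable is replaced by a Rademacher
sum, which is truncated at height `√3 / 2`. For the truncated part the hypothesis `hD` applies, and
the remainder has `L_2` norm at most `1 / 2`, so that any bound `B` improves to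
`(√3 / 2) * D + B / 2`. -/
theorem norm_sum_linear_le {d k : ℕ} (L : Fin k → (Fin d → 𝕜) →ₗ[𝕜] 𝕜) {D : ℝ}
    (hD : ∀ (ω : Fin k → ℤˣ) (g : Fin d → 𝕜), ‖∑ j, ((ω j : ℤ) : 𝕜) * L j g‖ ≤ D * ‖g‖)
    (hD0 : 0 ≤ D) (z : Fin k → Fin d → 𝕜) (hz : ∀ l, ∑ j, ‖z j l‖ ^ 2 ≤ 1) :
    ‖∑ j, L j (z j)‖ ≤ √3 * D := by
  let S : Set ℝ := {r | ∃ z : Fin k → Fin d → 𝕜, (∀ l, ∑ j, ‖z j l‖ ^ 2 ≤ 1) ∧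
    ‖∑ j, L j (z j)‖ = r}
  have hbdd : BddAbove S := by
    refine ⟨∑ j, ‖LinearMap.toContinuousLinearMap (L j)‖, ?_⟩
    rintro r ⟨z, hz, rfl⟩
    refine (norm_sum_le _ _).trans (Finset.sum_le_sum fun j _ => ?_)
    refine ((LinearMap.toContinuousLinearMap (L j)).le_opNorm (z j)).trans
      (mul_le_of_le_one_right (norm_nonneg _) ?_)
    refine (pi_norm_le_iff_of_nonneg zero_le_one).2 fun l => ?_
    rw [← sq_le_one_iff₀ (norm_nonneg _)]
    exact (Finset.single_le_sum (f := fun j => ‖z j l‖ ^ 2) (fun _ _ => by positivity)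
      (Finset.mem_univ j)).trans (hz l)
  have h3 : (0 : ℝ) < √3 := by positivity
  have key := le_div_of_forall_improve hbdd (D := √3 / 2 * D) (θ := 1 / 2) (by norm_num) ?_
  · exact (key _ ⟨z, hz, rfl⟩).trans_eq (by ring)
  clear z hz
  rintro B hB r ⟨z, hz, rfl⟩
  have hM : (0 : ℝ) < √3 / 2 := by positivity
  choose g hgM hgf hg using fun l => exists_truncation_signSum hM (fun j => z j l) (hz l)
  let r : (Fin k → ℤˣ) → Fin d → 𝕜 := fun ω l => signSum (fun j => z j l) ω - g l ω
  have hsum : ∀ j, ∑ ω : Fin k → ℤˣ, ((ω j : ℤ) : 𝕜) • ((fun l => g l ω) + r ω)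
      = (2 ^ k : 𝕜) • z j := fun j => by
    funext l
    simp only [Finset.sum_apply, Pi.smul_apply, Pi.add_apply, r, add_sub_cancel, smul_eq_mul]
    exact sum_sign_mul_signSum (fun j => z j l) j
  set R : Fin k → Fin d → 𝕜 := fun j => ∑ ω : Fin k → ℤˣ, ((ω j : ℤ) : 𝕜) • r ω with hR
  have e1 : (2 ^ k : 𝕜) * ∑ j, L j (z j)
      = ∑ ω : Fin k → ℤˣ, ∑ j, ((ω j : ℤ) : 𝕜) * L j (fun l => g l ω) + ∑ j, L j (R j) := by
    rw [Finset.sum_comm, ← Finset.sum_add_distrib, Finset.mul_sum]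
    refine Finset.sum_congr rfl fun j _ => ?_
    rw [← smul_eq_mul, ← map_smul, ← hsum]
    simp only [hR, map_sum, map_smul, map_add, smul_add, Finset.sum_add_distrib, smul_eq_mul]
  have n1 : ‖∑ ω : Fin k → ℤˣ, ∑ j, ((ω j : ℤ) : 𝕜) * L j (fun l => g l ω)‖
      ≤ 2 ^ k * (√3 / 2 * D) := by
    refine (norm_sum_le _ _).trans ((Finset.sum_le_card_nsmul _ _ (√3 / 2 * D)
      fun ω _ => ?_).trans_eq (by rw [Finset.card_univ, card_signs]; simp))
    refine (hD ω _).trans ?_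
    rw [mul_comm]
    gcongr
    exact (pi_norm_le_iff_of_nonneg hM.le).2 fun l => hgM l ω
  have n2 : ‖∑ j, L j (R j)‖ ≤ 2 ^ k / 2 * B := by
    have hne : ((2 ^ k / 2 : ℝ) : 𝕜) ≠ 0 := by
      exact_mod_cast (by positivity : (2 ^ k / 2 : ℝ) ≠ 0)
    have hn : ‖((2 ^ k / 2 : ℝ) : 𝕜)‖ = 2 ^ k / 2 := by
      rw [RCLike.norm_ofReal, abs_of_pos (by positivity)]
    have h := hB _ ⟨fun j => ((2 ^ k / 2 : ℝ) : 𝕜)⁻¹ • R j, fun l => ?_, rfl⟩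
    · have e : ∑ j, L j (R j)
          = ((2 ^ k / 2 : ℝ) : 𝕜) * ∑ j, L j (((2 ^ k / 2 : ℝ) : 𝕜)⁻¹ • R j) := by
        rw [Finset.mul_sum]
        refine Finset.sum_congr rfl fun j _ => ?_
        rw [map_smul, smul_eq_mul, mul_inv_cancel_left₀ hne]
      rw [e, norm_mul, hn]
      gcongr
    · have hb := sum_norm_sum_sign_mul_sq_le (fun ω => r ω l)
      have hs : ∑ ω, ‖r ω l‖ ^ 2 ≤ 2 ^ k / 4 := by
        refine (hg l).trans_eq ?_
        rw [div_pow, Real.sq_sqrt (by norm_num)]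
        ring
      simp only [Pi.smul_apply, norm_smul, norm_inv, hn, mul_pow, ← Finset.mul_sum]
      rw [inv_pow, inv_mul_le_one₀ (by positivity)]
      calc ∑ j, ‖R j l‖ ^ 2 ≤ 2 ^ k * ∑ ω, ‖r ω l‖ ^ 2 := by
            simpa [hR, Finset.sum_apply] using hb
        _ ≤ 2 ^ k * (2 ^ k / 4) := by gcongr
        _ = _ := by ring
  have n3 : 2 ^ k * ‖∑ j, L j (z j)‖ ≤ 2 ^ k * (√3 / 2 * D + 1 / 2 * B) := by
    calc 2 ^ k * ‖∑ j, L j (z j)‖ = ‖(2 ^ k : 𝕜) * ∑ j, L j (z j)‖ := by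
          rw [norm_mul, norm_pow, RCLike.norm_ofNat]
      _ ≤ 2 ^ k * (√3 / 2 * D) + 2 ^ k / 2 * B := by
          rw [e1]; exact (norm_add_le _ _).trans (add_le_add n1 n2)
      _ = _ := by ring
  exact le_of_mul_le_mul_left n3 (by positivity)

/-- The multilinear Grothendieck inequality: diagonal sums of an `(m + 2)`-linear form on products
of the spaces `ℓ_∞^d`, along families whose coordinates lie in the unit ball of `ℓ_2`. -/
theorem norm_sum_mul_multilinear_le {m : ℕ} {d : Fin (m + 2) → ℕ}
    (A : MultilinearMap 𝕜 (fun i => Fin (d i) → 𝕜) 𝕜) {C : ℝ} (hC : 0 ≤ C)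
    (hA : ∀ s, ‖A s‖ ≤ C * ∏ i, ‖s i‖) {k : ℕ} (c : Fin k → 𝕜) (hc : ∀ j, ‖c j‖ ≤ 1)
    (x : ∀ i, Fin k → Fin (d i) → 𝕜) (hx : ∀ i l, ∑ j, ‖x i j l‖ ^ 2 ≤ 1) :
    ‖∑ j, c j * A (fun i => x i j)‖ ≤ C * (grothendieckConstant 𝕜 * √3 ^ m) := by
  induction m generalizing C c with
  | zero => simpa using norm_sum_mul_bilinear_le A hC hA c hc x hx
  | succ m ih =>
    have hK := grothendieckConstant_nonneg 𝕜
    let y : ∀ i : Fin (m + 2), Fin k → Fin (d i.succ) → 𝕜 := fun i j => x i.succ j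
    let L : Fin k → (Fin (d 0) → 𝕜) →ₗ[𝕜] 𝕜 := fun j =>
      { toFun := fun z => c j * A.curryLeft z (fun i => y i j)
        map_add' := fun z z' => by rw [map_add, add_apply, mul_add]
        map_smul' := fun r z => by
          rw [map_smul, smul_apply, smul_eq_mul, smul_eq_mul, RingHom.id_apply]
          ring }
    have hL : ∀ j, L j (x 0 j) = c j * A (fun i => x i j) := fun j => by
      change c j * A.curryLeft _ _ = _
      rw [MultilinearMap.curryLeft_apply]
      congr 2
      exact Fin.cons_self_tail (fun i => x i j)
    have h := norm_sum_linear_le L (D := C * (grothendieckConstant 𝕜 * √3 ^ m)) ?_ (by positivity)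
      (x 0) (hx 0)
    · simp only [hL] at h
      exact h.trans_eq (by ring)
    · intro ω g
      have := ih (d := fun i => d i.succ) (A.curryLeft g) (C := C * ‖g‖) (by positivity)
        (fun s => ?_) (fun j => ((ω j : ℤ) : 𝕜) * c j) (fun j => ?_) y (fun i l => hx i.succ l)
      · simp only [mul_assoc] at this
        refine this.trans_eq (by ring)
      · rw [MultilinearMap.curryLeft_apply]
        refine (hA _).trans_eq ?_
        rw [Fin.prod_univ_succ]
        simp [mul_assoc]
      · rw [norm_mul, norm_sign, one_mul]; exact hc j

/-- The homogeneous form of the multilinear Grothendieck inequality. -/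
theorem norm_sum_mul_multilinear_le_prod {m : ℕ} {d : Fin (m + 2) → ℕ}
    (A : MultilinearMap 𝕜 (fun i => Fin (d i) → 𝕜) 𝕜) {C : ℝ} (hC : 0 ≤ C)
    (hA : ∀ s, ‖A s‖ ≤ C * ∏ i, ‖s i‖) {k : ℕ} (c : Fin k → 𝕜) (hc : ∀ j, ‖c j‖ ≤ 1)
    (x : ∀ i, Fin k → Fin (d i) → 𝕜) {W : Fin (m + 2) → ℝ} (hW : ∀ i, 0 ≤ W i)
    (hx : ∀ i l, ∑ j, ‖x i j l‖ ^ 2 ≤ W i ^ 2) :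
    ‖∑ j, c j * A (fun i => x i j)‖ ≤ C * (grothendieckConstant 𝕜 * √3 ^ m) * ∏ i, W i := by
  have hn : ∀ i, ‖((W i : ℝ) : 𝕜)‖ = W i := fun i => by simp [abs_of_nonneg (hW i)]
  -- A weight `W i = 0` forces `x i = 0`, so the rescaling is valid in this case too.
  have hsc : ∀ i j, x i j = ((W i : ℝ) : 𝕜) • (((W i : ℝ) : 𝕜)⁻¹ • x i j) := fun i j => by
    rcases (hW i).eq_or_lt with h0 | h0
    · funext l
      have h1 : ‖x i j l‖ ^ 2 ≤ 0 := by
        refine (Finset.single_le_sum (f := fun j => ‖x i j l‖ ^ 2) (fun _ _ => by positivity)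
          (Finset.mem_univ j)).trans ((hx i l).trans_eq (by rw [← h0]; norm_num))
      have : x i j l = 0 := by
        simpa using le_antisymm h1 (by positivity)
      simp [this]
    · rw [smul_inv_smul₀ (by exact_mod_cast h0.ne')]
  have h := norm_sum_mul_multilinear_le A hC hA c hc
    (fun i j => ((W i : ℝ) : 𝕜)⁻¹ • x i j) (fun i l => ?_)
  · have e : ∑ j, c j * A (fun i => x i j)
        = (∏ i, ((W i : ℝ) : 𝕜)) * ∑ j, c j * A (fun i => ((W i : ℝ) : 𝕜)⁻¹ • x i j) := by
      rw [Finset.mul_sum]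
      refine Finset.sum_congr rfl fun j _ => ?_
      conv_lhs => rw [funext fun i => hsc i j]
      rw [A.map_smul_univ, smul_eq_mul]
      ring
    have hP : 0 ≤ ∏ i, W i := Finset.prod_nonneg fun i _ => hW i
    rw [e, norm_mul, norm_prod, mul_comm]
    simp only [hn]
    gcongr
  · simp only [Pi.smul_apply, norm_smul, norm_inv, hn, mul_pow, ← Finset.mul_sum]
    rcases (hW i).eq_or_lt with h0 | h0
    · simp [← h0]
    · rw [inv_pow, inv_mul_le_one₀ (by positivity)]
      exact hx i l

/-! ### Multilinear forms on script-`ℒ_∞` spaces -/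

section
variable {E : Type*} [NormedAddCommGroup E] [NormedSpace 𝕜 E]

theorem sum_norm_apply_sq_le {k : ℕ} {x : Fin k → E} {w : ℝ}
    (hx : ∀ φ : StrongDual 𝕜 E, ‖φ‖ ≤ 1 → ∑ j, ‖φ (x j)‖ ^ 2 ≤ w ^ 2) (φ : StrongDual 𝕜 E) :
    ∑ j, ‖φ (x j)‖ ^ 2 ≤ (‖φ‖ * w) ^ 2 := by
  rcases (norm_nonneg φ).eq_or_lt with h0 | h0
  · have : φ = 0 := norm_eq_zero.1 h0.symm
    simp [this]
  · have hn : ‖((‖φ‖ : ℝ) : 𝕜)⁻¹‖ = ‖φ‖⁻¹ := by simp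
    have h := hx ((((‖φ‖ : ℝ) : 𝕜)⁻¹) • φ) (by rw [norm_smul, hn, inv_mul_cancel₀ h0.ne'])
    simp only [smul_apply, norm_smul, hn, mul_pow, ← Finset.mul_sum] at h
    rw [inv_pow, inv_mul_le_iff₀ (by positivity)] at h
    rwa [mul_pow]

/-- A finite family in a script-`ℒ_∞` space factors through some `ℓ_∞^d`: there are an operator
`u` from `ℓ_∞^d` and preimages `y j` of the `x j` whose coordinates are square summable with a
bound governed by the weak `ℓ_2` bound of the family. The coordinate functionals are extended to
the whole space by the Hahn-Banach theorem. -/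
theorem IsScriptLSpace.exists_factorization {lam : ℝ} (hE : IsScriptLSpace 𝕜 ∞ lam E) {k : ℕ}
    (x : Fin k → E) : ∃ (d : ℕ) (u : (Fin d → 𝕜) →ₗ[𝕜] E) (y : Fin k → Fin d → 𝕜) (p q : ℝ),
      0 ≤ p ∧ 0 ≤ q ∧ p * q ≤ lam ∧ (∀ j, u (y j) = x j) ∧ (∀ s, ‖u s‖ ≤ q * ‖s‖) ∧
      (∀ j, ‖y j‖ ≤ p * ‖x j‖) ∧
      ∀ w : ℝ, (∀ φ : StrongDual 𝕜 E, ‖φ‖ ≤ 1 → ∑ j, ‖φ (x j)‖ ^ 2 ≤ w ^ 2) →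
        ∀ l, ∑ j, ‖y j l‖ ^ 2 ≤ (p * w) ^ 2 := by
  obtain ⟨F, hF, _, v, hv⟩ := hE (Submodule.span 𝕜 (Set.range x))
    (FiniteDimensional.span_of_finite 𝕜 (Set.finite_range x))
  have hx : ∀ j, x j ∈ F := fun j => hF (Submodule.subset_span ⟨j, rfl⟩)
  refine ⟨_, F.subtype ∘ₗ v.symm.toLinearEquiv.toLinearMap ∘ₗ
    (WithLp.linearEquiv ∞ 𝕜 (Fin (Module.finrank 𝕜 F) → 𝕜)).symm.toLinearMap,
    fun j => WithLp.ofLp (v ⟨x j, hx j⟩), _, _, norm_nonneg _, norm_nonneg _, hv.le,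
    fun j => ?_, fun s => ?_, fun j => ?_, fun w hw l => ?_⟩
  · simp
  · have := (v.symm : PiLp ∞ (fun _ : Fin (Module.finrank 𝕜 F) => 𝕜) →L[𝕜] F).le_opNorm
      (WithLp.toLp ∞ s)
    simpa using this
  · have := (v : F →L[𝕜] PiLp ∞ (fun _ : Fin (Module.finrank 𝕜 F) => 𝕜)).le_opNorm ⟨x j, hx j⟩
    simpa using this
  · set V := (v : F →L[𝕜] PiLp ∞ (fun _ : Fin (Module.finrank 𝕜 F) => 𝕜)) with hV
    let f : StrongDual 𝕜 F := (PiLp.proj ∞ (fun _ : Fin (Module.finrank 𝕜 F) => 𝕜) l) ∘L V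
    obtain ⟨φ, hφ, hφn⟩ := exists_extension_norm_eq F f
    have hfn : ‖f‖ ≤ ‖V‖ := ContinuousLinearMap.opNorm_le_bound _ (norm_nonneg _) fun z =>
      (PiLp.norm_apply_le (V z) l).trans (V.le_opNorm z)
    have h := sum_norm_apply_sq_le hw φ
    have hval : ∀ j, φ (x j) = (v ⟨x j, hx j⟩) l := fun j => hφ ⟨x j, hx j⟩
    simp only [hval] at h
    refine h.trans ?_
    rw [mul_pow, mul_pow, hφn]
    gcongr

end

/-- Grothendieck's theorem for multilinear forms on script-`ℒ_∞` spaces: such forms are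
`(1; 2, …, 2)`-summing. -/
theorem norm_sum_mul_le_of_isScriptLSpace {m : ℕ} {X : Fin (m + 2) → Type*}
    [∀ i, NormedAddCommGroup (X i)] [∀ i, NormedSpace 𝕜 (X i)] {lam : Fin (m + 2) → ℝ}
    (hX : ∀ i, IsScriptLSpace 𝕜 ∞ (lam i) (X i)) (T : MultilinearMap 𝕜 X 𝕜) {C : ℝ} (hC : 0 ≤ C)
    (hT : ∀ s, ‖T s‖ ≤ C * ∏ i, ‖s i‖) {k : ℕ} (c : Fin k → 𝕜) (hc : ∀ j, ‖c j‖ ≤ 1)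
    (x : ∀ i, Fin k → X i) {w : Fin (m + 2) → ℝ} (hw : ∀ i, 0 ≤ w i)
    (hx : ∀ i, ∀ φ : StrongDual 𝕜 (X i), ‖φ‖ ≤ 1 → ∑ j, ‖φ (x i j)‖ ^ 2 ≤ w i ^ 2) :
    ‖∑ j, c j * T (fun i => x i j)‖
      ≤ C * (grothendieckConstant 𝕜 * √3 ^ m) * ∏ i, (lam i * w i) := by
  choose d u y p q hp hq hpq huy hu _ hy using fun i => (hX i).exists_factorization (x i)
  have hK := grothendieckConstant_nonneg 𝕜
  have h := norm_sum_mul_multilinear_le_prod (T.compLinearMap u) (C := C * ∏ i, q i)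
    (mul_nonneg hC (Finset.prod_nonneg fun i _ => hq i)) (fun s => ?_) c hc y
    (fun i => mul_nonneg (hp i) (hw i)) (fun i => hy i (w i) (hx i))
  · simp only [MultilinearMap.compLinearMap_apply, huy] at h
    calc _ ≤ _ := h
      _ = C * (grothendieckConstant 𝕜 * √3 ^ m) * ∏ i, (p i * q i * w i) := by
        simp only [Finset.prod_mul_distrib]; ring
      _ ≤ _ := by
        refine mul_le_mul_of_nonneg_left (Finset.prod_le_prod (fun i _ => ?_) fun i _ => ?_)
          (by positivity)
        · exact mul_nonneg (mul_nonneg (hp i) (hq i)) (hw i)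
        · exact mul_le_mul_of_nonneg_right (hpq i) (hw i)
  · rw [MultilinearMap.compLinearMap_apply, mul_assoc, ← Finset.prod_mul_distrib]
    refine (hT _).trans (mul_le_mul_of_nonneg_left ?_ hC)
    exact Finset.prod_le_prod (fun i _ => norm_nonneg _) fun i _ => hu i (s i)

/-! ### Weak `ℓ_p` norms -/

section
variable {E : Type*} [NormedAddCommGroup E] [NormedSpace 𝕜 E]

theorem ellNorm_two_eq {k : ℕ} {F : Type*} [NormedAddCommGroup F] (x : Fin k → F) :
    ellNorm 2 x = ENNReal.ofReal √(∑ j, ‖x j‖ ^ 2) := by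
  rw [ellNorm, if_neg (by simp), tsum_fintype, Real.sqrt_eq_rpow,
    ← ENNReal.ofReal_rpow_of_nonneg (by positivity) (by norm_num),
    ENNReal.ofReal_sum_of_nonneg fun _ _ => by positivity]
  norm_num

theorem weakEllNorm_ne_top (p : ℝ≥0∞) (hp : p = 2 ∨ p = ∞) {k : ℕ} (x : Fin k → E) :
    weakEllNorm 𝕜 p x ≠ ∞ := by
  have hφ : ∀ (φ : {φ : StrongDual 𝕜 E // ‖φ‖ ≤ 1}) j, ‖φ.1 (x j)‖ ≤ ‖x j‖ := fun φ j =>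
    (φ.1.le_opNorm _).trans (mul_le_of_le_one_left (norm_nonneg _) φ.2)
  rcases hp with rfl | rfl
  · refine ne_top_of_le_ne_top ENNReal.ofReal_ne_top (iSup_le fun φ => ?_)
      (b := ENNReal.ofReal √(∑ j, ‖x j‖ ^ 2))
    rw [ellNorm_two_eq]
    gcongr with j
    exact hφ φ j
  · refine ne_top_of_le_ne_top (b := ∑ j, ‖x j‖ₑ) (by simp) (iSup_le fun φ => ?_)
    rw [ellNorm, if_pos rfl]
    refine iSup_le fun j => ?_
    refine le_trans ?_ (Finset.single_le_sum (f := fun j => ‖x j‖ₑ) (fun _ _ => zero_le)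
      (Finset.mem_univ j))
    exact enorm_le_iff_norm_le.2 (hφ φ j)

theorem sum_norm_apply_sq_le_weakEllNorm {k : ℕ} (x : Fin k → E) (φ : StrongDual 𝕜 E)
    (hφ : ‖φ‖ ≤ 1) : ∑ j, ‖φ (x j)‖ ^ 2 ≤ (weakEllNorm 𝕜 2 x).toReal ^ 2 := by
  have h : ellNorm 2 (fun j => φ (x j)) ≤ weakEllNorm 𝕜 2 x :=
    le_iSup (fun φ : {φ : StrongDual 𝕜 E // ‖φ‖ ≤ 1} => ellNorm 2 fun j => φ.1 (x j)) ⟨φ, hφ⟩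
  rw [ellNorm_two_eq, ENNReal.ofReal_le_iff_le_toReal (weakEllNorm_ne_top 2 (.inl rfl) x)] at h
  exact (Real.sqrt_le_left ENNReal.toReal_nonneg).1 h

theorem norm_le_weakEllNorm_top {k : ℕ} (x : Fin k → E) (j : Fin k) :
    ‖x j‖ ≤ (weakEllNorm 𝕜 ∞ x).toReal := by
  obtain ⟨φ, hφ, hφx⟩ := exists_dual_vector'' 𝕜 (x j)
  have h : ellNorm ∞ (fun j => φ (x j)) ≤ weakEllNorm 𝕜 ∞ x :=
    le_iSup (fun φ : {φ : StrongDual 𝕜 E // ‖φ‖ ≤ 1} => ellNorm ∞ fun j => φ.1 (x j)) ⟨φ, hφ⟩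
  rw [ellNorm, if_pos rfl] at h
  have h' := (le_iSup (fun j => ‖φ (x j)‖ₑ) j).trans h
  rw [← ofReal_norm, ENNReal.ofReal_le_iff_le_toReal (weakEllNorm_ne_top ∞ (.inr rfl) x),
    hφx] at h'
  simpa using h'

/-- A weakly `2`-summable sequence is uniformly weakly `2`-summable over the dual unit ball: by
duality its partial sums with coefficients in the unit ball of `ℓ_2` are weakly bounded, so the
Banach-Steinhaus theorem applies. -/
theorem IsWeaklySummable.exists_bound_two {x : ℕ → E} (hx : IsWeaklySummable 𝕜 2 x) :
    ∃ w : ℝ, 0 ≤ w ∧ ∀ (k : ℕ) (φ : StrongDual 𝕜 E), ‖φ‖ ≤ 1 →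
      ∑ j : Fin k, ‖φ (x j)‖ ^ 2 ≤ w ^ 2 := by
  let I := {b : Σ k : ℕ, (Fin k → 𝕜) // ∑ j, ‖b.2 j‖ ^ 2 ≤ 1}
  obtain ⟨C, hC⟩ := banach_steinhaus (ι := I)
    (g := fun b => NormedSpace.inclusionInDoubleDual 𝕜 E (∑ j, b.1.2 j • x j)) (fun φ => by
      have hs : Summable fun j => ‖φ (x j)‖ ^ 2 := by
        simpa using (memℓp_gen_iff (p := 2) (by norm_num)).1 (hx φ)
      refine ⟨√(∑' j, ‖φ (x j)‖ ^ 2), fun b => ?_⟩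
      rw [NormedSpace.dual_def, map_sum]
      refine Real.le_sqrt_of_sq_le ?_
      have h1 : ‖∑ j, φ (b.1.2 j • x j)‖ ≤ ∑ j, ‖b.1.2 j‖ * ‖φ (x j)‖ :=
        (norm_sum_le _ _).trans_eq (Finset.sum_congr rfl fun _ _ => by simp)
      calc ‖∑ j, φ (b.1.2 j • x j)‖ ^ 2 ≤ (∑ j, ‖b.1.2 j‖ * ‖φ (x j)‖) ^ 2 := by gcongr
        _ ≤ (∑ j, ‖b.1.2 j‖ ^ 2) * ∑ j : Fin b.1.1, ‖φ (x j)‖ ^ 2 := Finset.sum_mul_sq_le_sq_mul_sq _ _ _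
        _ ≤ 1 * ∑ j : Fin b.1.1, ‖φ (x j)‖ ^ 2 := by gcongr; exact b.2
        _ ≤ _ := by
          rw [one_mul, ← Finset.sum_range fun j => ‖φ (x j)‖ ^ 2]
          exact hs.sum_le_tsum _ fun _ _ => by positivity)
  have hC0 : 0 ≤ C := (norm_nonneg _).trans (hC ⟨⟨0, 0⟩, by simp⟩)
  refine ⟨C, hC0, fun k φ hφ => ?_⟩
  set s := √(∑ j : Fin k, ‖φ (x j)‖ ^ 2) with hs
  have hs2 : s ^ 2 = ∑ j : Fin k, ‖φ (x j)‖ ^ 2 := Real.sq_sqrt (by positivity)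
  rw [← hs2]
  have hs0 : 0 ≤ s := Real.sqrt_nonneg _
  refine pow_le_pow_left₀ hs0 ?_ 2
  rcases hs0.eq_or_lt with h0 | h0
  · rw [← h0]; exact hC0
  have hn : ‖((s : ℝ) : 𝕜)⁻¹‖ = s⁻¹ := by simp [abs_of_pos h0]
  -- The extremal coefficients for `φ`.
  have hb := hC ⟨⟨k, fun j => ((s : ℝ) : 𝕜)⁻¹ * star (φ (x j))⟩, by
    simp only [norm_mul, hn, norm_star, mul_pow, ← Finset.mul_sum, ← hs2]
    rw [inv_pow, inv_mul_cancel₀ (by positivity)]⟩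
  have h1 := ContinuousLinearMap.le_of_opNorm_le _ hb φ
  rw [NormedSpace.dual_def, map_sum] at h1
  have h2 : ∑ j : Fin k, φ ((((s : ℝ) : 𝕜)⁻¹ * star (φ (x j))) • x j) = ((s : ℝ) : 𝕜) := by
    have : ∑ j : Fin k, star (φ (x j)) * φ (x j) = ((s ^ 2 : ℝ) : 𝕜) := by
      rw [hs2]
      push_cast
      exact Finset.sum_congr rfl fun j _ => by rw [RCLike.star_def, RCLike.conj_mul]
    simp only [map_smul, smul_eq_mul, mul_assoc, ← Finset.mul_sum, this]
    push_cast
    have : ((s : ℝ) : 𝕜) ≠ 0 := by exact_mod_cast h0.ne'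
    field_simp
  rw [h2, RCLike.norm_ofReal, abs_of_pos h0] at h1
  exact h1.trans (mul_le_of_le_one_right hC0 hφ)

theorem IsWeaklySummable.exists_bound_top {x : ℕ → E} (hx : IsWeaklySummable 𝕜 ∞ x) :
    ∃ Z : ℝ, 0 ≤ Z ∧ ∀ j, ‖x j‖ ≤ Z := by
  obtain ⟨C, hC⟩ := banach_steinhaus
    (g := fun j => NormedSpace.inclusionInDoubleDual 𝕜 E (x j)) (fun φ => by
      obtain ⟨C, hC⟩ := memℓp_infty_iff.1 (hx φ)
      exact ⟨C, fun j => by rw [NormedSpace.dual_def]; exact hC ⟨j, rfl⟩⟩)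
  have hC0 : 0 ≤ C := (norm_nonneg _).trans (hC 0)
  refine ⟨C, hC0, fun j => NormedSpace.norm_le_dual_bound 𝕜 _ hC0 fun φ => ?_⟩
  have := ContinuousLinearMap.le_of_opNorm_le _ (hC j) φ
  rwa [NormedSpace.dual_def] at this

end

/-! ### Cotype of the dual -/

section
variable {E : Type*} [NormedAddCommGroup E] [NormedSpace 𝕜 E]

theorem sum_norm_apply_single_le {d : ℕ} (u : (Fin d → 𝕜) →ₗ[𝕜] E) {q : ℝ} (hq : 0 ≤ q)
    (hu : ∀ s, ‖u s‖ ≤ q * ‖s‖) (φ : StrongDual 𝕜 E) :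
    ∑ l, ‖φ (u (Pi.single l 1))‖ ≤ q * ‖φ‖ := by
  choose c hc1 hc using fun l => RCLike.exists_norm_eq_mul_self (φ (u (Pi.single l 1)))
  have h : ((∑ l, ‖φ (u (Pi.single l 1))‖ : ℝ) : 𝕜) = φ (u c) := by
    conv_rhs => rw [pi_eq_sum_univ' c]
    push_cast
    simp only [map_sum, map_smul, smul_eq_mul]
    exact Finset.sum_congr rfl fun l _ => hc l
  have h' : ∑ l, ‖φ (u (Pi.single l 1))‖ = ‖φ (u c)‖ := by
    rw [← h, RCLike.norm_ofReal, abs_of_nonneg (by positivity)]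
  rw [h']
  calc ‖φ (u c)‖ ≤ ‖φ‖ * (q * ‖c‖) := (φ.le_opNorm _).trans (by gcongr; exact hu c)
    _ ≤ ‖φ‖ * (q * 1) := by
      gcongr
      exact (pi_norm_le_iff_of_nonneg zero_le_one).2 fun l => (hc1 l).le
    _ = _ := by ring

theorem norm_apply_le_sum_single {d : ℕ} (u : (Fin d → 𝕜) →ₗ[𝕜] E) (φ : StrongDual 𝕜 E)
    (y : Fin d → 𝕜) : ‖φ (u y)‖ ≤ ‖y‖ * ∑ l, ‖φ (u (Pi.single l 1))‖ := by
  conv_lhs => rw [pi_eq_sum_univ' y]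
  rw [map_sum, map_sum, Finset.mul_sum]
  refine (norm_sum_le _ _).trans (Finset.sum_le_sum fun l _ => ?_)
  rw [map_smul, map_smul, norm_smul]
  gcongr
  exact norm_le_pi_norm y l

theorem sqrt_sum_sum_sq_le {k d : ℕ} (b : Fin k → Fin d → ℝ) :
    √(∑ j, (∑ l, b j l) ^ 2) ≤ ∑ l, √(∑ j, b j l ^ 2) := by
  have h := norm_sum_le Finset.univ fun l : Fin d => (WithLp.toLp 2 fun j => b j l :
    EuclideanSpace ℝ (Fin k))
  simpa [EuclideanSpace.norm_eq] using h

theorem exists_norm_le_two_mul_norm_apply (φ : StrongDual 𝕜 E) :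
    ∃ x, ‖x‖ ≤ 1 ∧ ‖φ‖ ≤ 2 * ‖φ x‖ := by
  rcases (norm_nonneg φ).eq_or_lt with h0 | h0
  · exact ⟨0, by simp, by rw [← h0]; positivity⟩
  · obtain ⟨x, hx, h⟩ := φ.exists_lt_apply_of_lt_opNorm (half_lt_self h0)
    exact ⟨x, hx.le, by linarith⟩

/-- The dual of a script-`ℒ_∞` space has cotype `2`. On a copy of `ℓ_∞^d` that
norms them up to a factor, the functionals become elements of `ℓ_1^d`, where cotype `2` follows
coordinatewise from Khinchine's inequality. -/
theorem IsScriptLSpace.hasCotype_dual {lam : ℝ} (hE : IsScriptLSpace 𝕜 ∞ lam E) :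
    HasCotype 𝕜 2 (StrongDual 𝕜 E) := by
  refine ⟨(4 * lam).toNNReal, fun k φ => ?_⟩
  choose x hx1 hx using fun j => exists_norm_le_two_mul_norm_apply (φ j)
  obtain ⟨d, u, y, p, q, hp, hq, hpq, huy, hu, hyp, -⟩ := hE.exists_factorization x
  have hlam : 0 ≤ lam := (mul_nonneg hp hq).trans hpq
  set Y : (Fin k → ℝ) → StrongDual 𝕜 E := fun ε => ∑ j, ((ε j : ℝ) : 𝕜) • φ j with hY
  have hYc : Continuous fun ε => ‖Y ε‖ ^ 2 := by
    have : Continuous Y := continuous_finsetSum _ fun j _ =>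
      Continuous.smul (f := fun ε : Fin k → ℝ => ((ε j : ℝ) : 𝕜))
        (RCLike.continuous_ofReal.comp (continuous_apply j)) continuous_const
    exact this.norm.pow 2
  have hint := integral_comp_rademacher hYc
  set I := ∫ t in (0 : ℝ)..1, ‖Y fun j => rademacher j t‖ ^ 2 with hI
  have hI0 : 0 ≤ I := intervalIntegral.integral_nonneg zero_le_one fun _ _ => by positivity
  set b : Fin k → Fin d → 𝕜 := fun j l => φ j (u (Pi.single l 1)) with hb
  have h1 : ∀ j, ‖φ j‖ ≤ 2 * p * ∑ l, ‖b j l‖ := fun j => by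
    have hy1 : ‖y j‖ ≤ p := (hyp j).trans (mul_le_of_le_one_right hp (hx1 j))
    have := norm_apply_le_sum_single u (φ j) (y j)
    rw [huy] at this
    calc ‖φ j‖ ≤ 2 * ‖φ j (x j)‖ := hx j
      _ ≤ 2 * (p * ∑ l, ‖b j l‖) := by
        gcongr; exact this.trans (by gcongr)
      _ = _ := by ring
  have h2 : √(∑ j, ‖φ j‖ ^ 2) ≤ 2 * p * ∑ l, √(∑ j, ‖b j l‖ ^ 2) := by
    calc √(∑ j, ‖φ j‖ ^ 2) ≤ √(∑ j, (∑ l, 2 * p * ‖b j l‖) ^ 2) := by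
          gcongr with j; rw [← Finset.mul_sum]; exact h1 j
      _ ≤ ∑ l, √(∑ j, (2 * p * ‖b j l‖) ^ 2) := sqrt_sum_sum_sq_le _
      _ = _ := by
        rw [Finset.mul_sum]
        refine Finset.sum_congr rfl fun l _ => ?_
        simp only [mul_pow _ (‖_‖), ← Finset.mul_sum]
        rw [Real.sqrt_mul (by positivity), Real.sqrt_sq (by positivity)]
  have h3 : 2 ^ k * ∑ l, √(∑ j, ‖b j l‖ ^ 2)
      ≤ 2 * ∑ ω : Fin k → ℤˣ, q * ‖Y fun j => ((ω j : ℤ) : ℝ)‖ := by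
    calc 2 ^ k * ∑ l, √(∑ j, ‖b j l‖ ^ 2)
        ≤ ∑ l, 2 * ∑ ω, ‖signSum (fun j => b j l) ω‖ := by
          rw [Finset.mul_sum]
          exact Finset.sum_le_sum fun l _ => sqrt_le_sum_norm_signSum fun j => b j l
      _ = 2 * ∑ ω, ∑ l, ‖signSum (fun j => b j l) ω‖ := by
          rw [← Finset.mul_sum, Finset.sum_comm]
      _ ≤ _ := by
          gcongr with ω
          refine le_trans (le_of_eq ?_)
            (sum_norm_apply_single_le u hq hu (Y fun j => ((ω j : ℤ) : ℝ)))
          refine Finset.sum_congr rfl fun l _ => ?_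
          simp [hY, signSum, hb]
  have h4 : ∑ ω : Fin k → ℤˣ, ‖Y fun j => ((ω j : ℤ) : ℝ)‖ ≤ 2 ^ k * √I := by
    have := Finset.sum_mul_sq_le_sq_mul_sq Finset.univ (fun _ => (1 : ℝ))
      (fun ω : Fin k → ℤˣ => ‖Y fun j => ((ω j : ℤ) : ℝ)‖)
    simp only [one_mul, one_pow, Finset.sum_const, Finset.card_univ, card_signs, ← hint] at this
    refine abs_le_of_sq_le_sq' ?_ (by positivity) |>.2
    refine this.trans_eq ?_
    rw [mul_pow, Real.sq_sqrt hI0]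
    simp; ring
  have h5 : ∑ l, √(∑ j, ‖b j l‖ ^ 2) ≤ 2 * q * √I := by
    refine le_of_mul_le_mul_left (h3.trans ?_) (by positivity : (0 : ℝ) < 2 ^ k)
    rw [← Finset.mul_sum]
    calc _ ≤ 2 * (q * (2 ^ k * √I)) := by gcongr
      _ = _ := by ring
  have h6 : √(∑ j, ‖φ j‖ ^ 2) ≤ 4 * lam * √I := by
    calc _ ≤ 2 * p * (2 * q * √I) := h2.trans (by gcongr)
      _ = 4 * (p * q) * √I := by ring
      _ ≤ _ := by gcongr
  rw [ellNorm_two_eq]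
  change _ ≤ ENNReal.ofReal (4 * lam) * ENNReal.ofReal √I
  rw [← ENNReal.ofReal_mul (by positivity)]
  exact ENNReal.ofReal_le_ofReal h6

end

/-! ### Forms with values in the dual of the last space -/

/-- Diagonal square sums are controlled by the multilinear Grothendieck theorem alone: with
`t j = T (x j)`, replacing the last variable `x_n` by `conj (t j) • x_n` turns a bounded family
into one whose weak `ℓ_2` norm is at most `‖t‖₂ * sup ‖x_n‖`. -/
theorem sum_norm_sq_le_of_isScriptLSpace {m : ℕ} {X : Fin (m + 2) → Type*}
    [∀ i, NormedAddCommGroup (X i)] [∀ i, NormedSpace 𝕜 (X i)] {lam : Fin (m + 2) → ℝ}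
    (hX : ∀ i, IsScriptLSpace 𝕜 ∞ (lam i) (X i)) (T : ContinuousMultilinearMap 𝕜 X 𝕜) {k : ℕ}
    (x : ∀ i, Fin k → X i) {w : Fin (m + 2) → ℝ} (hw : ∀ i, 0 ≤ w i)
    (hx : ∀ i, i ≠ Fin.last (m + 1) → ∀ φ : StrongDual 𝕜 (X i), ‖φ‖ ≤ 1 →
      ∑ j, ‖φ (x i j)‖ ^ 2 ≤ w i ^ 2)
    (hlast : ∀ j, ‖x (Fin.last (m + 1)) j‖ ≤ w (Fin.last (m + 1))) :
    ∑ j, ‖T (fun i => x i j)‖ ^ 2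
      ≤ (‖T‖ * (grothendieckConstant 𝕜 * √3 ^ m) * ∏ i, (lam i * w i)) ^ 2 := by
  set t : Fin k → 𝕜 := fun j => T fun i => x i j with ht
  set B := ‖T‖ * (grothendieckConstant 𝕜 * √3 ^ m) * ∏ i, (lam i * w i) with hB
  set s := √(∑ j, ‖t j‖ ^ 2) with hs
  have hs0 : 0 ≤ s := Real.sqrt_nonneg _
  have hs2 : s ^ 2 = ∑ j, ‖t j‖ ^ 2 := Real.sq_sqrt (by positivity)
  have h := norm_sum_mul_le_of_isScriptLSpace hX T.toMultilinearMap (norm_nonneg T) T.le_opNorm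
    (fun _ : Fin k => (1 : 𝕜)) (fun _ => by simp)
    (fun i j => Function.update (fun i => x i j) (Fin.last (m + 1))
      (star (t j) • x (Fin.last (m + 1)) j) i)
    (w := fun i => (if i = Fin.last (m + 1) then s else 1) * w i)
    (fun i => by have := hw i; split_ifs <;> positivity) (fun i φ hφ => ?_)
  · have e : ∑ j, (1 : 𝕜) * T.toMultilinearMap (fun i => Function.update (fun i => x i j)
        (Fin.last (m + 1)) (star (t j) • x (Fin.last (m + 1)) j) i) = ((s ^ 2 : ℝ) : 𝕜) := by
      rw [hs2]
      push_cast
      refine Finset.sum_congr rfl fun j _ => ?_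
      rw [one_mul]
      refine (T.map_update_smul _ _ _ _).trans ?_
      rw [Function.update_eq_self, smul_eq_mul, RCLike.star_def]
      exact RCLike.conj_mul (t j)
    have e' : ∏ i, (lam i * ((if i = Fin.last (m + 1) then s else 1) * w i))
        = s * ∏ i, (lam i * w i) := by
      simp only [Finset.prod_mul_distrib, Finset.prod_ite_eq', Finset.mem_univ, if_true]
      ring
    rw [e, e', RCLike.norm_ofReal, abs_of_nonneg (by positivity)] at h
    have h' : s * s ≤ s * B := by
      calc s * s = s ^ 2 := by ring
        _ ≤ _ := h
        _ = _ := by rw [hB]; ring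
    rw [← hs2]
    rcases hs0.eq_or_lt with h0 | h0
    · rw [← h0]; simpa using sq_nonneg B
    · exact pow_le_pow_left₀ hs0 (le_of_mul_le_mul_left h' h0) 2
  · by_cases hi : i = Fin.last (m + 1)
    · subst hi
      simp only [Function.update_self, map_smul, norm_smul, norm_star, if_true]
      rw [mul_pow, hs2, Finset.sum_mul]
      refine Finset.sum_le_sum fun j _ => ?_
      rw [mul_pow]
      gcongr
      calc ‖φ (x (Fin.last (m + 1)) j)‖ ≤ ‖φ‖ * ‖x (Fin.last (m + 1)) j‖ := φ.le_opNorm _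
        _ ≤ 1 * w (Fin.last (m + 1)) := by gcongr; exact hlast j
        _ = _ := one_mul _
    · simpa [Function.update_of_ne hi, hi] using hx i hi φ hφ

theorem isSummingAt_zero_of_isScriptLSpace {m : ℕ} {X : Fin (m + 2) → Type*}
    [∀ i, NormedAddCommGroup (X i)] [∀ i, NormedSpace 𝕜 (X i)] {lam : Fin (m + 2) → ℝ}
    (hX : ∀ i, IsScriptLSpace 𝕜 ∞ (lam i) (X i)) (T : ContinuousMultilinearMap 𝕜 X 𝕜) :
    IsSummingAt 2 (fun i : Fin (m + 2) => if (i : ℕ) = m + 2 - 1 then ∞ else 2) T 0 := by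
  intro x hx
  have hb : ∀ i, ∃ w : ℝ, 0 ≤ w ∧
      (i ≠ Fin.last (m + 1) → ∀ (k : ℕ) (φ : StrongDual 𝕜 (X i)), ‖φ‖ ≤ 1 →
        ∑ j : Fin k, ‖φ (x i j)‖ ^ 2 ≤ w ^ 2) ∧
      (i = Fin.last (m + 1) → ∀ j, ‖x i j‖ ≤ w) := fun i => by
    have hxi := hx i
    beta_reduce at hxi
    by_cases hi : i = Fin.last (m + 1)
    · rw [if_pos (by simp [hi])] at hxi
      obtain ⟨w, hw, h⟩ := hxi.exists_bound_top
      exact ⟨w, hw, fun h' => absurd hi h', fun _ => h⟩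
    · rw [if_neg (fun h => hi (Fin.ext (by simpa using h)))] at hxi
      obtain ⟨w, hw, h⟩ := hxi.exists_bound_two
      exact ⟨w, hw, fun _ => h, fun h' => absurd h' hi⟩
  choose w hw h2 hlast using hb
  have hT0 : T 0 = 0 := T.map_zero
  refine memℓp_gen ?_
  simp only [Pi.zero_apply, zero_add, hT0, sub_zero, ENNReal.toReal_ofNat, Real.rpow_ofNat]
  refine summable_of_sum_range_le (c := (‖T‖ * (grothendieckConstant 𝕜 * √3 ^ m) *
    ∏ i, (lam i * w i)) ^ 2) (fun _ => by positivity) fun k => ?_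
  rw [Finset.sum_range fun j => ‖T fun i => x i j‖ ^ 2]
  exact sum_norm_sq_le_of_isScriptLSpace hX T (fun i j => x i j) hw (fun i hi => h2 i hi k)
    fun j => hlast _ rfl j

/-- The estimate behind the bound for the summing norm. The vectors `y j = T (x_j, ·)` of the dual
of the last space are estimated by the cotype inequality, and the norm of `∑ r_j(t) y j` is the
supremum over `z` in the unit ball of diagonal sums of the forms `T (·, z)` with one variable less,
to which the multilinear Grothendieck theorem applies. -/
theorem ellNorm_two_le_of_isCotypeConstant {m : ℕ} {X : Fin (m + 3) → Type*}
    [∀ i, NormedAddCommGroup (X i)] [∀ i, NormedSpace 𝕜 (X i)] {lam : Fin (m + 3) → ℝ}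
    (hlam : ∀ i, 1 < lam i) (hX : ∀ i, IsScriptLSpace 𝕜 ∞ (lam i) (X i))
    (T : ContinuousMultilinearMap 𝕜 X 𝕜) {C : ℝ≥0}
    (hC : IsCotypeConstant 𝕜 2 (StrongDual 𝕜 (X (Fin.last (m + 2)))) C) {k : ℕ}
    (x : ∀ i, Fin k → X i) :
    ellNorm 2 (fun j => T (fun i => x i j)) ≤
      C * ENNReal.ofReal (grothendieckConstant 𝕜 * √3 ^ m * ‖T‖ * ∏ i, lam i) *
        ∏ i : Fin (m + 3), weakEllNorm 𝕜 (if (i : ℕ) = m + 3 - 1 then ∞ else 2) (x i) := by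
  have hK := grothendieckConstant_nonneg 𝕜
  have hlam0 : ∀ i, 0 ≤ lam i := fun i => (zero_le_one.trans (hlam i).le)
  set w : Fin (m + 2) → ℝ := fun i => (weakEllNorm 𝕜 2 (x i.castSucc)).toReal with hw
  have hw0 : ∀ i, 0 ≤ w i := fun i => ENNReal.toReal_nonneg
  set Z := (weakEllNorm 𝕜 ∞ (x (Fin.last (m + 2)))).toReal with hZ
  have hZ0 : 0 ≤ Z := ENNReal.toReal_nonneg
  set y : Fin k → StrongDual 𝕜 (X (Fin.last (m + 2))) :=
    fun j => T.curryRight fun i => x i.castSucc j with hy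
  have hyx : ∀ j z, y j z = T (Fin.snoc (fun i => x i.castSucc j) z) := fun j z => rfl
  have hTy : ∀ j, T (fun i => x i j) = y j (x (Fin.last (m + 2)) j) := fun j => by
    rw [hyx]
    congr 1
    exact (Fin.snoc_init_self fun i => x i j).symm
  set P := ∏ i : Fin (m + 2), (lam i.castSucc * w i) with hP
  have hP0 : 0 ≤ P := Finset.prod_nonneg fun i _ => mul_nonneg (hlam0 _) (hw0 i)
  set D := ‖T‖ * (grothendieckConstant 𝕜 * √3 ^ m) * P with hD
  have hD0 : 0 ≤ D := by positivity
  have hsup : ∀ t, ‖∑ j : Fin k, ((rademacher (j : ℕ) t : ℝ) : 𝕜) • y j‖ ≤ D := fun t => by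
    refine ContinuousLinearMap.opNorm_le_bound _ hD0 fun z => ?_
    have h := norm_sum_mul_le_of_isScriptLSpace (fun i => hX (Fin.castSucc i))
      ((ContinuousLinearMap.apply 𝕜 𝕜 z).compContinuousMultilinearMap T.curryRight).toMultilinearMap
      (C := ‖T‖ * ‖z‖) (by positivity) (fun v => ?_)
      (fun j : Fin k => ((rademacher (j : ℕ) t : ℝ) : 𝕜)) (fun j => ?_)
      (fun i j => x i.castSucc j) hw0 fun i φ hφ => sum_norm_apply_sq_le_weakEllNorm _ φ hφ
    · refine le_trans (le_of_eq ?_) (h.trans_eq (by rw [hD]; ring))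
      simp only [sum_apply, smul_apply, smul_eq_mul]
      rfl
    · change ‖T.curryRight v z‖ ≤ _
      rw [T.curryRight_apply]
      refine (T.le_opNorm _).trans_eq ?_
      rw [Fin.prod_univ_castSucc]
      simp only [Fin.snoc_castSucc, Fin.snoc_last]
      ring
    · rw [RCLike.norm_ofReal]; exact abs_rademacher_le_one j t
  have hI : √(∫ t in (0 : ℝ)..1, ‖∑ j : Fin k, ((rademacher (j : ℕ) t : ℝ) : 𝕜) • y j‖ ^ 2)
      ≤ D := by
    rw [Real.sqrt_le_left hD0]
    have := intervalIntegral.norm_integral_le_of_norm_le_const (a := 0) (b := 1) (C := D ^ 2)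
      (f := fun t => ‖∑ j : Fin k, ((rademacher (j : ℕ) t : ℝ) : 𝕜) • y j‖ ^ 2) (fun t _ => by
        rw [norm_pow, norm_norm]
        exact pow_le_pow_left₀ (norm_nonneg _) (hsup t) 2)
    simpa using (le_abs_self _).trans this
  have hPle : P ≤ (∏ i, lam i) * ∏ i, w i := by
    rw [hP, Finset.prod_mul_distrib, Fin.prod_univ_castSucc lam]
    refine mul_le_mul_of_nonneg_right ?_ (Finset.prod_nonneg fun i _ => hw0 i)
    exact le_mul_of_one_le_right (Finset.prod_nonneg fun i _ => hlam0 _) (hlam _).le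
  have hprod : ∏ i : Fin (m + 3), weakEllNorm 𝕜 (if (i : ℕ) = m + 3 - 1 then ∞ else 2) (x i)
      = ENNReal.ofReal (∏ i, w i) * ENNReal.ofReal Z := by
    rw [Fin.prod_univ_castSucc, ENNReal.ofReal_prod_of_nonneg fun i _ => hw0 i]
    congr 1
    · refine Finset.prod_congr rfl fun i _ => ?_
      rw [if_neg (by have := i.2; simp only [Fin.val_castSucc]; omega),
        ENNReal.ofReal_toReal (weakEllNorm_ne_top 2 (.inl rfl) _)]
    · rw [if_pos (by simp), ENNReal.ofReal_toReal (weakEllNorm_ne_top ∞ (.inr rfl) _)]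
  have h1 : ellNorm 2 (fun j => T (fun i => x i j)) ≤ ENNReal.ofReal Z * ellNorm 2 y := by
    rw [ellNorm_two_eq, ellNorm_two_eq, ← ENNReal.ofReal_mul hZ0]
    refine ENNReal.ofReal_le_ofReal ?_
    rw [← Real.sqrt_sq hZ0, ← Real.sqrt_mul (sq_nonneg Z), Finset.mul_sum]
    gcongr with j
    rw [hTy, ← mul_pow]
    gcongr
    rw [mul_comm]
    refine ((y j).le_opNorm _).trans ?_
    gcongr
    exact norm_le_weakEllNorm_top _ j
  have hR : D ≤ grothendieckConstant 𝕜 * √3 ^ m * ‖T‖ * (∏ i, lam i) * ∏ i, w i := by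
    calc D = grothendieckConstant 𝕜 * √3 ^ m * ‖T‖ * P := by rw [hD]; ring
      _ ≤ grothendieckConstant 𝕜 * √3 ^ m * ‖T‖ * ((∏ i, lam i) * ∏ i, w i) := by gcongr
      _ = _ := by ring
  have hlamP : 0 ≤ ∏ i, lam i := Finset.prod_nonneg fun i _ => hlam0 i
  calc ellNorm 2 (fun j => T (fun i => x i j))
      ≤ ENNReal.ofReal Z * (C * ENNReal.ofReal D) :=
        h1.trans (by gcongr; exact (hC k y).trans (by gcongr))
    _ ≤ ENNReal.ofReal Z * (C * ENNReal.ofReal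
          (grothendieckConstant 𝕜 * √3 ^ m * ‖T‖ * (∏ i, lam i) * ∏ i, w i)) := by
        gcongr
    _ = _ := by
        rw [hprod, ENNReal.ofReal_mul (by positivity)]
        ring

theorem summingNorm_le_of_isScriptLSpace {m : ℕ} {X : Fin (m + 3) → Type*}
    [∀ i, NormedAddCommGroup (X i)] [∀ i, NormedSpace 𝕜 (X i)] {lam : Fin (m + 3) → ℝ}
    (hlam : ∀ i, 1 < lam i) (hX : ∀ i, IsScriptLSpace 𝕜 ∞ (lam i) (X i))
    (T : ContinuousMultilinearMap 𝕜 X 𝕜) :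
    summingNorm 2 (fun i : Fin (m + 3) => if (i : ℕ) = m + 3 - 1 then ∞ else 2) T ≤
      cotypeConstant 𝕜 2 (StrongDual 𝕜 (X (Fin.last (m + 2)))) *
        ENNReal.ofReal (grothendieckConstant 𝕜 * √3 ^ m * ‖T‖ * ∏ i, lam i) := by
  set R := grothendieckConstant 𝕜 * √3 ^ m * ‖T‖ * ∏ i, lam i with hR
  have hC : ∀ C : ℝ≥0, IsCotypeConstant 𝕜 2 (StrongDual 𝕜 (X (Fin.last (m + 2)))) C →
      summingNorm 2 (fun i : Fin (m + 3) => if (i : ℕ) = m + 3 - 1 then ∞ else 2) T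
        ≤ C * ENNReal.ofReal R := fun C hC => by
    -- The infimum defining the summing norm runs over positive constants only.
    refine ENNReal.le_of_forall_pos_le_add fun ε hε _ => ?_
    refine (iInf₂_le (C * R.toNNReal + ε) ⟨by positivity, fun k x => ?_⟩).trans_eq
      (by push_cast; rfl)
    refine (ellNorm_two_le_of_isCotypeConstant hlam hX T hC x).trans ?_
    push_cast
    gcongr
    exact le_self_add
  obtain ⟨C₀, hC₀⟩ := (hX (Fin.last (m + 2))).hasCotype_dual
  rcases eq_or_ne (ENNReal.ofReal R) 0 with h0 | h0
  · have := hC C₀ hC₀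
    rw [h0, mul_zero] at this
    exact this.trans zero_le
  · rw [← ENNReal.div_le_iff h0 ENNReal.ofReal_ne_top]
    exact le_iInf₂ fun C h => (ENNReal.div_le_iff h0 ENNReal.ofReal_ne_top).2 (hC C h)

end

theorem theorem102 {𝕜 : Type*} [RCLike 𝕜] (n : ℕ) (hn : 2 ≤ n)
    (X : Fin n → Type*) [∀ i, NormedAddCommGroup (X i)] [∀ i, NormedSpace 𝕜 (X i)]
    [∀ i, CompleteSpace (X i)]
    (lam : Fin n → ℝ) (hlam : ∀ i, 1 < lam i)
    (hX : ∀ i, IsScriptLSpace 𝕜 ∞ (lam i) (X i))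
    (T : ContinuousMultilinearMap 𝕜 X 𝕜) :
    IsSummingAt 2 (fun i : Fin n => if (i : ℕ) = n - 1 then ∞ else 2) T 0 ∧
    HasCotype 𝕜 2 (StrongDual 𝕜 (X ⟨n - 1, by omega⟩)) ∧
    (3 ≤ n →
      summingNorm 2 (fun i : Fin n => if (i : ℕ) = n - 1 then ∞ else 2) T ≤
        cotypeConstant 𝕜 2 (StrongDual 𝕜 (X ⟨n - 1, by omega⟩)) *
          ENNReal.ofReal (grothendieckConstant 𝕜 * (3 : ℝ) ^ (((n : ℝ) - 3) / 2) * ‖T‖ *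
            ∏ i, lam i)) := by
  refine ⟨?_, (hX _).hasCotype_dual, fun h3 => ?_⟩
  · obtain ⟨m, rfl⟩ := Nat.exists_eq_add_of_le' hn
    exact isSummingAt_zero_of_isScriptLSpace hX T
  · obtain ⟨m, rfl⟩ := Nat.exists_eq_add_of_le' h3
    have e : (3 : ℝ) ^ ((((m + 3 : ℕ) : ℝ) - 3) / 2) = √3 ^ m := by
      rw [Real.sqrt_eq_rpow, ← Real.rpow_natCast, ← Real.rpow_mul (by norm_num)]
      congr 1
      push_cast
      ring
    rw [e]
    exact summingNorm_le_of_isScriptLSpace hlam hX T
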